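/- An orientably-regular map $\mathcal M(G:r,s)$ is identified with its orientation-preserving automorphism group $G=\langle r,s\rangle$, where $r$ and $s$ are the one-step rotations about a face and an incident vertex, and $t:=rs$ is an involution. It has type $\{m,n\}$ if $r$ and $s$ have orders $m$ and $n$ respectively. It is reflexible if some automorphism of $G$ maps $r\mapsto r^{-1}$ and $s\mapsto s^{-1}$, and chiral otherwise. Let $n=4a+7+i$, where $i\in\{-1,1\}$ and $a\ge 1$ is an integer. Consider the points $1,\dots,2a$, $1',\dots,(2a)'$, $\alpha,\alpha',\beta,\beta',\gamma,\gamma',\delta,\delta',\varepsilon$, together with one more point $\zeta$ if $i=1$, and let $k$ be their number, so that $k=n+3$ if $i=-1$ and $k=n+2$ if $i=1$. Define the permutation $s:=s_i$ of these $k$ points by $$s_{-1}:=(1,2,\dots,2a,\alpha,\alpha',\beta,(2a)',(2a-1)',\dots,1',\gamma,\delta,\gamma')(\delta',\varepsilon),$$ $$s_{1}:=(1,2,\dots,2a,\alpha,\alpha',\beta,\beta',\zeta,(2a)',(2a-1)',\dots,1',\gamma,\delta,\gamma')(\delta',\varepsilon),$$ and let $$t:=(\alpha,\alpha')(\beta,\beta')(\gamma,\gamma')(\delta,\delta')\prod_{j=1}^{2a}(j,j').$$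 Let $G:=\langle s,t\rangle$ and let $r$ be the element with $rs=t$. Then $G=A_k$, the alternating group on the $k$ points, and $\mathcal M(G:r,s)$ is a chiral map of type $\{4,n\}$. -/

import Mathlib

/-- An orientably-regular map `M(G : r, s)`, identified with its group `G` of
orientation-preserving automorphisms together with the one-step rotation `r` about a face and
the one-step rotation `s` about an incident vertex: `r` and `s` generate `G`, and `r * s` is an
involution. -/
structure OrientablyRegularMap (G : Type*) [Group G] where
  r : G
  s : G
  generate : Subgroup.closure {r, s} = ⊤
  involution : orderOf (r * s) = 2

namespace OrientablyRegularMap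

variable {G : Type*} [Group G]

/-- The map has (Schläfli) type `{m, n}`: its faces have length `m`, its vertices valency `n`. -/
def HasType (M : OrientablyRegularMap G) (m n : ℕ) : Prop :=
  orderOf M.r = m ∧ orderOf M.s = n

/-- The map is reflexible: some automorphism of the group `G` inverts both generators. -/
def IsReflexible (M : OrientablyRegularMap G) : Prop :=
  ∃ φ : G ≃* G, φ M.r = M.r⁻¹ ∧ φ M.s = M.s⁻¹

/-- An orientably-regular map is chiral if it is not reflexible. -/
def IsChiral (M : OrientablyRegularMap G) : Prop :=
  ¬ M.IsReflexible

end OrientablyRegularMap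

namespace EvenFour

/-- The points of the permutation diagram. With `j : Fin (2 * a)`, `num j` and `num' j` are the
points labelled `j + 1` and `(j + 1)'`, so that the labels run from `1` to `2 * a`. The point
`ζ` occurs only when `i = 1`. -/
inductive Point (a : ℕ) (i : ℤ) : Type
  | num (j : Fin (2 * a))
  | num' (j : Fin (2 * a))
  | α
  | α'
  | β
  | β'
  | γ
  | γ'
  | δ
  | δ'
  | ε
  | ζ (h : i = 1)
  deriving DecidableEq, Fintype

open Point Equiv

/-- The permutation `s_i`: for `i = 1` it is
`(1, …, 2a, α, α', β, β', ζ, (2a)', …, 1', γ, δ, γ') (δ', ε)`, and otherwise (for `i = -1`)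
`(1, …, 2a, α, α', β, (2a)', …, 1', γ, δ, γ') (δ', ε)`. -/
def s (a : ℕ) (i : ℤ) : Perm (Point a i) :=
  if h : i = 1 then
    ((List.finRange (2 * a)).map num ++ [α, α', β, β', ζ h] ++
      (List.finRange (2 * a)).reverse.map num' ++ [γ, δ, γ']).formPerm * swap δ' ε
  else
    ((List.finRange (2 * a)).map num ++ [α, α', β] ++
      (List.finRange (2 * a)).reverse.map num' ++ [γ, δ, γ']).formPerm * swap δ' ε

/-- The involution `t = (α, α') (β, β') (γ, γ') (δ, δ') ∏ (j, j')`, where `j` runs from `1` to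
`2a`. -/
def t (a : ℕ) (i : ℤ) : Perm (Point a i) :=
  swap α α' * swap β β' * swap γ γ' * swap δ δ' *
    ((List.finRange (2 * a)).map fun j => swap (num j) (num' j)).prod

/-- The permutation group `G = ⟨s, t⟩`. -/
def G (a : ℕ) (i : ℤ) : Subgroup (Perm (Point a i)) :=
  Subgroup.closure {s a i, t a i}

end EvenFour

/-! Numbering the points along the long cycle of `s` turns `s` into a rotation modulo N = 4a + 6 +
`extra i` = n, together with one transposition, and turns `t` into a piecewise reflection on the
natural numbers. Cycle structures of words in s and t then become linear arithmetic in a, uniformly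
in a.

Equality with the alternating group comes from Jordan's theorem: a primitive group containing a
3-cycle contains the alternating group, and s, t are both even. A power of a short word is a
3-cycle: (t s³)²⁰ for i = 1, (t s⁴)¹⁴ for i = -1 and a ≥ 2, and (t s t s⁻⁴)⁸ for i = -1 and a = 1.
For primitivity, a nontrivial block can be translated to meet the support of the 3-cycle c; it is
then c-stable and contains the whole support, and relations among the support points force s and t
to preserve it, so it is everything (`MulAction.isPreprimitive_of_threeCycle`,
`eq_alternatingGroup_of_threeCycle`).

For chirality, a reflection would yield an automorphism inverting s and fixing t. Except for i = -1,
a = 1, a conjugator g is chosen so that c and g c g⁻¹ do not commute, while their images under that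
automorphism have disjoint supports (`isChiral_of_threeCycle`). In the exceptional case a word of
order 30 would be sent to one of order 9. -/

namespace EvenFour

open Point Equiv

/-! ### Coordinates: s as a rotation, t as a reflection. -/

/-- The number of points `β', ζ` that lie between `β` and `(2a)'` in the long cycle of `s`. -/
def extra (i : ℤ) : ℕ := if i = 1 then 2 else 0

/-- The position of a point: the points of the long cycle of `s` are numbered in cyclic order
from `0`, and then come `δ'`, `ε` and (for `i ≠ 1`) `β'`. -/
def pos {a : ℕ} {i : ℤ} : Point a i → ℕ
  | num j => j
  | num' j => 4 * a + 2 + extra i - j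
  | α => 2 * a
  | α' => 2 * a + 1
  | β => 2 * a + 2
  | β' => if i = 1 then 2 * a + 3 else 4 * a + 8
  | γ => 4 * a + 3 + extra i
  | δ => 4 * a + 4 + extra i
  | γ' => 4 * a + 5 + extra i
  | δ' => 4 * a + 6 + extra i
  | ε => 4 * a + 7 + extra i
  | ζ _ => 2 * a + 4

theorem pos_injective {a : ℕ} {i : ℤ} : Function.Injective (pos (a := a) (i := i)) := by
  intro x y h
  by_cases hi : i = 1 <;> cases x <;> cases y <;> simp only [pos, extra, hi, if_true, if_false] at h <;>
    first
      | rfl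
      | (exfalso; omega)
      | (congr 1; ext; omega)

theorem exists_pos_eq {a : ℕ} {i : ℤ} {p : ℕ} (h : p < 4 * a + 9 + extra i / 2) :
    ∃ x : Point a i, pos x = p := by
  by_cases hi : i = 1
  · simp only [extra, hi, if_true] at h
    by_cases h1 : p < 2 * a
    · exact ⟨num ⟨p, h1⟩, rfl⟩
    by_cases h2 : 2 * a + 5 ≤ p ∧ p ≤ 4 * a + 4
    · exact ⟨num' ⟨4 * a + 4 - p, by omega⟩, by simp [pos, extra, hi]; omega⟩
    have h3 : p = 2 * a ∨ p = 2 * a + 1 ∨ p = 2 * a + 2 ∨ p = 2 * a + 3 ∨ p = 2 * a + 4 ∨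
      p = 4 * a + 5 ∨ p = 4 * a + 6 ∨ p = 4 * a + 7 ∨ p = 4 * a + 8 ∨ p = 4 * a + 9 := by omega
    rcases h3 with h | h | h | h | h | h | h | h | h | h
    exacts [⟨α, by simp [pos, h]⟩, ⟨α', by simp [pos, h]⟩, ⟨β, by simp [pos, h]⟩,
      ⟨β', by simp [pos, h, hi]⟩, ⟨ζ hi, by simp [pos, h]⟩, ⟨γ, by simp [pos, h, hi, extra]⟩,
      ⟨δ, by simp [pos, h, hi, extra]⟩, ⟨γ', by simp [pos, h, hi, extra]⟩,
      ⟨δ', by simp [pos, h, hi, extra]⟩, ⟨ε, by simp [pos, h, hi, extra]⟩]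
  · simp only [extra, hi, if_false] at h
    by_cases h1 : p < 2 * a
    · exact ⟨num ⟨p, h1⟩, rfl⟩
    by_cases h2 : 2 * a + 3 ≤ p ∧ p ≤ 4 * a + 2
    · exact ⟨num' ⟨4 * a + 2 - p, by omega⟩, by simp [pos, extra, hi]; omega⟩
    have h3 : p = 2 * a ∨ p = 2 * a + 1 ∨ p = 2 * a + 2 ∨ p = 4 * a + 8 ∨
      p = 4 * a + 3 ∨ p = 4 * a + 4 ∨ p = 4 * a + 5 ∨ p = 4 * a + 6 ∨ p = 4 * a + 7 := by omega
    rcases h3 with h | h | h | h | h | h | h | h | h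
    exacts [⟨α, by simp [pos, h]⟩, ⟨α', by simp [pos, h]⟩, ⟨β, by simp [pos, h]⟩,
      ⟨β', by simp [pos, h, hi]⟩, ⟨γ, by simp [pos, h, hi, extra]⟩,
      ⟨δ, by simp [pos, h, hi, extra]⟩, ⟨γ', by simp [pos, h, hi, extra]⟩,
      ⟨δ', by simp [pos, h, hi, extra]⟩, ⟨ε, by simp [pos, h, hi, extra]⟩]

theorem pos_lt {a : ℕ} {i : ℤ} (x : Point a i) : pos x < 4 * a + 9 + extra i / 2 := by
  by_cases hi : i = 1 <;> cases x <;> simp only [pos, extra, hi, if_true, if_false] <;> omega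

theorem card_point (a : ℕ) (i : ℤ) : Fintype.card (Point a i) = 4 * a + 9 + extra i / 2 := by
  rw [← Fintype.card_fin (4 * a + 9 + extra i / 2)]
  refine Fintype.card_of_bijective (f := fun x : Point a i => ⟨pos x, pos_lt x⟩) ⟨?_, ?_⟩
  · intro x y h
    exact pos_injective (by simpa using h)
  · rintro ⟨p, hp⟩
    obtain ⟨x, hx⟩ := exists_pos_eq (i := i) hp
    exact ⟨x, by simp [hx]⟩

/-- The action of `s ^ k` on positions, when the long cycle has length `N`. -/
def rot (N k p : ℕ) : ℕ :=
  if p < N then (if p + k < N then p + k else p + k - N)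
  else if p = N then (if k % 2 = 0 then N else N + 1)
  else if p = N + 1 then (if k % 2 = 0 then N + 1 else N)
  else p

/-- The action of `t` on positions; `e` is `extra i` and `b` is the position of `β'`. -/
def mirror (a e b p : ℕ) : ℕ :=
  if p < 2 * a then 4 * a + 2 + e - p
  else if p = 2 * a then 2 * a + 1
  else if p = 2 * a + 1 then 2 * a
  else if p = 2 * a + 2 then b
  else if p = b then 2 * a + 2
  -- ζ is present only when e = 2; for e = 0 this position belongs to an ordinary primed point and
  -- must fall through to the reflection below.
  else if p = 2 * a + 4 ∧ e = 2 then 2 * a + 4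
  else if p ≤ 4 * a + 2 + e then 4 * a + 2 + e - p
  else if p = 4 * a + 3 + e then 4 * a + 5 + e
  else if p = 4 * a + 5 + e then 4 * a + 3 + e
  else if p = 4 * a + 4 + e then 4 * a + 6 + e
  else if p = 4 * a + 6 + e then 4 * a + 4 + e
  else p

/-- A list whose positions read 0, …, N - 1 in order has as its cycle the successor map modulo N, so
cycles are handled without list indices. -/
theorem formPerm_apply_of_map_eq_range {X : Type*} [DecidableEq X] {f : X → ℕ}
    (hf : Function.Injective f) {l : List X} {N : ℕ} (h : l.map f = List.range N) (x : X) :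
    f (l.formPerm x) = if f x < N then (f x + 1) % N else f x := by
  have hlen : l.length = N := by simpa using congrArg List.length h
  have hget : ∀ k (hk : k < l.length), f (l[k]) = k := by
    intro k hk
    have : (l.map f)[k]'(by simpa using hk) = k := by simp [h]
    simpa using this
  have hnd : l.Nodup := List.Nodup.of_map f (h ▸ List.nodup_range)
  split_ifs with hx
  · have hxe : x = l[f x]'(hlen ▸ hx) := hf (hget _ _).symm
    have := List.formPerm_apply_getElem l hnd (f x) (hlen ▸ hx)
    rw [← hxe] at this
    rw [this, hget, hlen]
  · rw [List.formPerm_apply_of_notMem]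
    intro hm
    apply hx
    have := List.mem_map_of_mem (f := f) hm
    rw [h] at this
    simpa using this

/-- The entries of the long cycle of `s`. -/
def longCycle (a : ℕ) (i : ℤ) : List (Point a i) :=
  if h : i = 1 then
    (List.finRange (2 * a)).map num ++ [α, α', β, β', ζ h] ++
      (List.finRange (2 * a)).reverse.map num' ++ [γ, δ, γ']
  else
    (List.finRange (2 * a)).map num ++ [α, α', β] ++
      (List.finRange (2 * a)).reverse.map num' ++ [γ, δ, γ']

theorem s_eq (a : ℕ) (i : ℤ) : s a i = (longCycle a i).formPerm * swap δ' ε := by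
  unfold s longCycle
  split_ifs <;> rfl

theorem map_pos_num (a : ℕ) (i : ℤ) :
    ((List.finRange (2 * a)).map (num : _ → Point a i)).map pos = List.range (2 * a) := by
  rw [List.map_map]
  exact List.map_coe_finRange_eq_range

theorem map_pos_num' (a : ℕ) (i : ℤ) :
    ((List.finRange (2 * a)).reverse.map (num' : _ → Point a i)).map pos =
      (List.range (2 * a)).map (2 * a + 3 + extra i + ·) := by
  apply List.ext_getElem
  · simp
  · intro k h1 h2
    simp only [List.length_map, List.length_range] at h2
    simp only [List.getElem_map, List.getElem_reverse, List.getElem_finRange, pos,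
      List.getElem_range, List.length_finRange, Fin.val_cast]
    omega

theorem map_pos_longCycle (a : ℕ) (i : ℤ) :
    (longCycle a i).map pos = List.range (4 * a + 6 + extra i) := by
  have hrange : ∀ A B : ℕ, List.range (A + B) = List.range A ++ (List.range B).map (A + ·) :=
    fun A B => List.range_add
  unfold longCycle
  split_ifs with hi
  · have h : 4 * a + 6 + extra i = 2 * a + 5 + 2 * a + 3 := by simp [extra, hi]; omega
    rw [h, hrange (2 * a + 5 + 2 * a) 3, hrange (2 * a + 5) (2 * a), hrange (2 * a) 5,
      List.map_append, List.map_append, List.map_append, map_pos_num, map_pos_num']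
    simp [List.range_succ, pos, hi, extra]
    omega
  · have h : 4 * a + 6 + extra i = 2 * a + 3 + 2 * a + 3 := by simp [extra, hi]; omega
    rw [h, hrange (2 * a + 3 + 2 * a) 3, hrange (2 * a + 3) (2 * a), hrange (2 * a) 3,
      List.map_append, List.map_append, List.map_append, map_pos_num, map_pos_num']
    simp [List.range_succ, pos, hi, extra]
    omega

theorem pos_swap {a : ℕ} {i : ℤ} (u v x : Point a i) :
    pos (swap u v x) = if pos x = pos u then pos v else if pos x = pos v then pos u else pos x := by
  simp only [swap_apply_def, pos_injective.eq_iff]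
  split_ifs <;> rfl

theorem pos_s {a : ℕ} {i : ℤ} (x : Point a i) :
    pos (s a i x) = rot (4 * a + 6 + extra i) 1 (pos x) := by
  rw [s_eq, Perm.mul_apply, formPerm_apply_of_map_eq_range pos_injective (map_pos_longCycle a i),
    pos_swap]
  have hδ : pos (δ' : Point a i) = 4 * a + 6 + extra i := rfl
  have hε : pos (ε : Point a i) = 4 * a + 6 + extra i + 1 := by simp only [pos]; omega
  simp only [hδ, hε, rot]
  generalize pos x = p
  generalize 4 * a + 6 + extra i = N
  by_cases h1 : p + 1 < N
  · have := Nat.mod_eq_of_lt h1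
    grind
  by_cases h2 : p + 1 = N
  · have := Nat.mod_self N
    grind
  · have h3 : ¬ p < N := by omega
    have h4 : ¬ N < N := lt_irrefl N
    grind

/-- The bound on k is needed because `rot` subtracts N at most once. -/
theorem pos_s_pow {a : ℕ} {i : ℤ} {k : ℕ} (hk : k ≤ 4 * a + 6 + extra i) (x : Point a i) :
    pos ((s a i ^ k) x) = rot (4 * a + 6 + extra i) k (pos x) := by
  induction k with
  | zero => simp [rot]; split_ifs <;> omega
  | succ k ih =>
    rw [pow_succ', Perm.mul_apply, pos_s, ih (by omega)]
    generalize pos x = p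
    generalize 4 * a + 6 + extra i = N at *
    grind [rot]

theorem prod_swap_apply {a : ℕ} {i : ℤ} (l : List (Fin (2 * a))) (hl : l.Nodup) (x : Point a i) :
    (l.map fun j => swap (num j) (num' j)).prod x =
      match x with
      | num j => if j ∈ l then num' j else num j
      | num' j => if j ∈ l then num j else num' j
      | y => y := by
  induction l with
  | nil => cases x <;> simp
  | cons b l ih =>
    rw [List.nodup_cons] at hl
    rw [List.map_cons, List.prod_cons, Perm.mul_apply, ih hl.2]
    cases x with
    | num j =>
      by_cases hj : j = b
      · subst hj; simp [hl.1]
      · by_cases hm : j ∈ l <;> simp [hm, hj, swap_apply_def]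
    | num' j =>
      by_cases hj : j = b
      · subst hj; simp [hl.1]
      · by_cases hm : j ∈ l <;> simp [hm, hj, swap_apply_def]
    | _ => simp [swap_apply_def]

theorem t_num {a : ℕ} {i : ℤ} (j : Fin (2 * a)) : t a i (num j) = num' j := by
  simp [t, prod_swap_apply _ (List.nodup_finRange _), swap_apply_def]

theorem t_num' {a : ℕ} {i : ℤ} (j : Fin (2 * a)) : t a i (num' j) = num j := by
  simp [t, prod_swap_apply _ (List.nodup_finRange _), swap_apply_def]

/-- The position of `β'`. -/
def posβ' (a : ℕ) (i : ℤ) : ℕ := if i = 1 then 2 * a + 3 else 4 * a + 8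

theorem t_α {a : ℕ} {i : ℤ} : t a i α = α' := by
  simp [t, prod_swap_apply _ (List.nodup_finRange _), swap_apply_def]

theorem t_α' {a : ℕ} {i : ℤ} : t a i α' = α := by
  simp [t, prod_swap_apply _ (List.nodup_finRange _), swap_apply_def]

theorem t_β {a : ℕ} {i : ℤ} : t a i β = β' := by
  simp [t, prod_swap_apply _ (List.nodup_finRange _), swap_apply_def]

theorem t_β' {a : ℕ} {i : ℤ} : t a i β' = β := by
  simp [t, prod_swap_apply _ (List.nodup_finRange _), swap_apply_def]

theorem t_γ {a : ℕ} {i : ℤ} : t a i γ = γ' := by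
  simp [t, prod_swap_apply _ (List.nodup_finRange _), swap_apply_def]

theorem t_γ' {a : ℕ} {i : ℤ} : t a i γ' = γ := by
  simp [t, prod_swap_apply _ (List.nodup_finRange _), swap_apply_def]

theorem t_δ {a : ℕ} {i : ℤ} : t a i δ = δ' := by
  simp [t, prod_swap_apply _ (List.nodup_finRange _), swap_apply_def]

theorem t_δ' {a : ℕ} {i : ℤ} : t a i δ' = δ := by
  simp [t, prod_swap_apply _ (List.nodup_finRange _), swap_apply_def]

theorem t_ε {a : ℕ} {i : ℤ} : t a i ε = ε := by
  simp [t, prod_swap_apply _ (List.nodup_finRange _), swap_apply_def]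

theorem t_ζ {a : ℕ} {i : ℤ} (h : i = 1) : t a i (ζ h) = (ζ h) := by
  simp [t, prod_swap_apply _ (List.nodup_finRange _), swap_apply_def]

theorem mirror_of_num {a e b p : ℕ} (h : p < 2 * a) : mirror a e b p = 4 * a + 2 + e - p :=
  if_pos h

theorem mirror_of_num' {a e b p : ℕ} (h1 : 2 * a + 3 + e ≤ p) (h2 : p ≤ 4 * a + 2 + e)
    (hb : p ≠ b) : mirror a e b p = 4 * a + 2 + e - p := by
  unfold mirror
  rw [if_neg (by omega), if_neg (by omega), if_neg (by omega), if_neg (by omega), if_neg hb,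
    if_neg (by omega), if_pos h2]

theorem pos_t {a : ℕ} {i : ℤ} (x : Point a i) :
    pos (t a i x) = mirror a (extra i) (posβ' a i) (pos x) := by
  cases x with
  | num j => rw [t_num, mirror_of_num (by exact j.2)]; rfl
  | num' j =>
    have hj : (j : ℕ) < 2 * a := j.2
    have h1 : pos (num' j : Point a i) = 4 * a + 2 + extra i - j := rfl
    have h2 : pos (num j : Point a i) = j := rfl
    have hb : 4 * a + 2 + extra i - j ≠ posβ' a i := by
      unfold extra posβ'
      split_ifs <;> omega
    rw [t_num', h1, h2, mirror_of_num' (by omega) (by omega) hb]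
    omega
  | α =>
    rw [t_α]
    by_cases hi : i = 1 <;> simp only [pos, mirror, extra, posβ', hi, if_true, if_false] <;>
      grind
  | α' =>
    rw [t_α']
    by_cases hi : i = 1 <;> simp only [pos, mirror, extra, posβ', hi, if_true, if_false] <;>
      grind
  | β =>
    rw [t_β]
    by_cases hi : i = 1 <;> simp only [pos, mirror, extra, posβ', hi, if_true, if_false] <;>
      grind
  | β' =>
    rw [t_β']
    by_cases hi : i = 1 <;> simp only [pos, mirror, extra, posβ', hi, if_true, if_false] <;>
      grind
  | γ =>
    rw [t_γ]
    by_cases hi : i = 1 <;> simp only [pos, mirror, extra, posβ', hi, if_true, if_false] <;>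
      grind
  | γ' =>
    rw [t_γ']
    by_cases hi : i = 1 <;> simp only [pos, mirror, extra, posβ', hi, if_true, if_false] <;>
      grind
  | δ =>
    rw [t_δ]
    by_cases hi : i = 1 <;> simp only [pos, mirror, extra, posβ', hi, if_true, if_false] <;>
      grind
  | δ' =>
    rw [t_δ']
    by_cases hi : i = 1 <;> simp only [pos, mirror, extra, posβ', hi, if_true, if_false] <;>
      grind
  | ε =>
    rw [t_ε]
    by_cases hi : i = 1 <;> simp only [pos, mirror, extra, posβ', hi, if_true, if_false] <;>
      grind
  | ζ h =>
    rw [t_ζ]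
    by_cases hi : i = 1 <;> simp only [pos, mirror, extra, posβ', hi, if_true, if_false] <;>
      grind

end EvenFour

/-! ### General facts on 3-cycles, blocks and commutation. -/

open scoped Pointwise

theorem Equiv.Perm.isThreeCycle_of_apply {X : Type*} [Fintype X] [DecidableEq X]
    {c : Equiv.Perm X} {x y z : X} (hxy : x ≠ y) (hxz : x ≠ z) (hyz : y ≠ z)
    (h1 : c x = y) (h2 : c y = z) (h3 : c z = x)
    (hfix : ∀ w, w ≠ x → w ≠ y → w ≠ z → c w = w) : c.IsThreeCycle := by
  have : c = swap x z * swap x y := by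
    ext w
    by_cases hx : w = x
    · subst hx; simp [h1, swap_apply_of_ne_of_ne hxy.symm hyz]
    by_cases hy : w = y
    · subst hy; simp [h2]
    by_cases hz : w = z
    · subst hz; simp [h3, swap_apply_of_ne_of_ne hxz.symm hyz.symm]
    · simp [hfix w hx hy hz, swap_apply_of_ne_of_ne hx hz, swap_apply_of_ne_of_ne hx hy]
  rw [this]
  exact isThreeCycle_swap_mul_swap_same hxz hxy hyz.symm

/-- A transitive permutation group that contains a three-cycle is primitive as soon as no proper
block contains the support of that three-cycle. -/
theorem MulAction.isPreprimitive_of_threeCycle {X : Type*} {G : Subgroup (Equiv.Perm X)}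
    [MulAction.IsPretransitive G X] {c : Equiv.Perm X} (hc : c ∈ G) {x y z : X}
    (h1 : c x = y) (h2 : c y = z) (h3 : c z = x)
    (hfix : ∀ w, w ≠ x → w ≠ y → w ≠ z → c w = w)
    (H : ∀ B : Set X, MulAction.IsBlock G B → x ∈ B → y ∈ B → z ∈ B → B = Set.univ) :
    MulAction.IsPreprimitive G X := by
  refine ⟨fun {B} hB => ?_⟩
  rw [MulAction.IsTrivialBlock, or_iff_not_imp_left, Set.not_subsingleton_iff]
  rintro ⟨b, hb, b', hb', hne⟩
  obtain ⟨g, hg⟩ := MulAction.exists_smul_eq G b x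
  have hxB : x ∈ g • B := hg ▸ Set.smul_mem_smul_set hb
  have hwB : g • b' ∈ g • B := Set.smul_mem_smul_set hb'
  have hwx : g • b' ≠ x := by
    rw [← hg]
    exact fun h => hne (MulAction.injective g h).symm
  generalize g • b' = w at hwB hwx
  have hB' : MulAction.IsBlock G (g • B) := hB.translate g
  suffices h : g • B = Set.univ by
    rw [← Set.smul_set_univ (a := g)] at h
    exact smul_left_cancel g h
  generalize g • B = C at *
  -- A block meeting its translate by c equals that translate, so one point staying inside makes the
  -- block c-stable.
  have key : ∀ u ∈ C, c u ∈ C → ∀ v ∈ C, c v ∈ C := by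
    intro u hu hcu v hv
    have h : (⟨c, hc⟩ : G) • C = C := hB'.smul_eq_of_mem (a := u) hu hcu
    rw [← h]
    exact Set.smul_mem_smul_set (a := (⟨c, hc⟩ : G)) hv
  have hstab : ∀ v ∈ C, c v ∈ C := by
    -- The second point w supplies such a witness: if it lies in the support, c carries x to w = y
    -- or w = z to x; otherwise c fixes w.
    by_cases hy : w = y
    · exact key x hxB (by rwa [h1, ← hy])
    by_cases hz : w = z
    · exact key w hwB (by rwa [hz, h3])
    · exact key w hwB (by rwa [hfix w hwx hy hz])
  have hyC : y ∈ C := h1 ▸ hstab x hxB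
  exact H C hB' hxB hyC (h2 ▸ hstab y hyC)

theorem not_commute_of_apply {X : Type*} {c d : Equiv.Perm X} {w : X} (h1 : c w ≠ w)
    (h2 : c (d w) = d w) : ¬ Commute c d := by
  intro h
  apply h1
  apply d.injective
  rw [← Equiv.Perm.mul_apply, ← h.eq, Equiv.Perm.mul_apply, h2]

namespace EvenFour

open Point Equiv

variable {a : ℕ} {i : ℤ}

/-! ### Orders of s and t, transitivity, parity. -/

theorem pos_pow_apply {g : Perm (Point a i)} {U : ℕ → ℕ} (h : ∀ x, pos (g x) = U (pos x))
    (k : ℕ) (x : Point a i) : pos ((g ^ k) x) = U^[k] (pos x) := by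
  induction k with
  | zero => rfl
  | succ k ih => rw [pow_succ', Perm.mul_apply, h, ih, Function.iterate_succ_apply']

theorem s_pow_eq_one (a : ℕ) (i : ℤ) : s a i ^ (4 * a + 6 + extra i) = 1 := by
  ext x
  apply pos_injective
  -- N is even, so the N-th power also kills the transposition (δ', ε).
  have he : (4 * a + 6 + extra i) % 2 = 0 := by unfold extra; split_ifs <;> omega
  rw [pos_s_pow le_rfl, Perm.one_apply]
  unfold rot
  rw [he]
  split_ifs <;> omega

theorem pos_s_pow_inv {k : ℕ} (hk : k ≤ 4 * a + 6 + extra i) (x : Point a i) :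
    pos ((s a i ^ k)⁻¹ x) = rot (4 * a + 6 + extra i) (4 * a + 6 + extra i - k) (pos x) := by
  rw [← pos_s_pow (Nat.sub_le _ _)]
  congr 2
  rw [inv_eq_iff_mul_eq_one, ← pow_add, Nat.add_sub_cancel' hk, s_pow_eq_one]

theorem orderOf_s (a : ℕ) (i : ℤ) : orderOf (s a i) = 4 * a + 6 + extra i := by
  rw [orderOf_eq_iff (by omega)]
  refine ⟨s_pow_eq_one a i, fun m hm h0 h => ?_⟩
  obtain ⟨x, hx⟩ := exists_pos_eq (a := a) (i := i) (p := 0) (by omega)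
  have h1 := pos_s_pow hm.le x
  rw [h, Perm.one_apply, hx] at h1
  simp (disch := omega) only [rot, if_pos] at h1
  omega

theorem t_mul_t (a : ℕ) (i : ℤ) : t a i * t a i = 1 := by
  ext x
  rw [Perm.mul_apply, Perm.one_apply]
  cases x <;> simp [t_num, t_num', t_α, t_α', t_β, t_β', t_γ, t_γ', t_δ, t_δ', t_ε, t_ζ, *]

theorem t_inv (a : ℕ) (i : ℤ) : (t a i)⁻¹ = t a i :=
  inv_eq_of_mul_eq_one_left (t_mul_t a i)

theorem t_ne_one (a : ℕ) (i : ℤ) : t a i ≠ 1 := by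
  intro h
  have := t_α (a := a) (i := i)
  simp [h] at this

theorem pos_α : pos (α : Point a i) = 2 * a := rfl
theorem pos_α' : pos (α' : Point a i) = 2 * a + 1 := rfl
theorem pos_β' : pos (β' : Point a i) = posβ' a i := rfl
theorem pos_δ : pos (δ : Point a i) = 4 * a + 4 + extra i := rfl
theorem pos_δ' : pos (δ' : Point a i) = 4 * a + 6 + extra i := rfl
theorem pos_ε : pos (ε : Point a i) = 4 * a + 7 + extra i := rfl

theorem eq_β'_of_not_lt {x : Point a i} (h : ¬ pos x < 4 * a + 6 + extra i) (h1 : x ≠ δ')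
    (h2 : x ≠ ε) : x = β' := by
  apply pos_injective
  have h1' := pos_injective.ne h1
  have h2' := pos_injective.ne h2
  have := pos_lt x
  rw [pos_δ'] at h1'
  rw [pos_ε] at h2'
  rw [pos_β']
  unfold extra at *
  unfold posβ'
  split_ifs at * <;> omega

/-- The long cycle is a single orbit of s; t links it to δ' through δ and to β' through β, and s
links δ' to ε. -/
theorem eq_univ_of_invariant {B : Set (Point a i)} (hs : ∀ x ∈ B, s a i x ∈ B)
    (ht : ∀ x ∈ B, t a i x ∈ B) (hne : B.Nonempty) : B = Set.univ := by
  have hpow : ∀ k, ∀ x ∈ B, (s a i ^ k) x ∈ B := by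
    intro k
    induction k with
    | zero => exact fun x hx => hx
    | succ k ih => exact fun x hx => by rw [pow_succ']; exact hs _ (ih x hx)
  have hcyc : ∀ x ∈ B, pos x < 4 * a + 6 + extra i → ∀ y : Point a i,
      pos y < 4 * a + 6 + extra i → y ∈ B := by
    intro x hx hpx y hpy
    by_cases hle : pos x ≤ pos y
    · convert hpow (pos y - pos x) x hx
      apply pos_injective
      rw [pos_s_pow (by omega)]
      simp (disch := omega) only [rot, if_pos]
      omega
    · convert hpow (pos y + (4 * a + 6 + extra i) - pos x) x hx
      apply pos_injective
      rw [pos_s_pow (by omega)]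
      simp (disch := omega) only [rot, if_pos, if_neg]
      omega
  have hδ : pos (δ : Point a i) < 4 * a + 6 + extra i := by simp [pos]
  have hβ : pos (β : Point a i) < 4 * a + 6 + extra i := by simp [pos]; omega
  have hx : ∃ x ∈ B, pos x < 4 * a + 6 + extra i := by
    obtain ⟨x, hx⟩ := hne
    by_cases hp : pos x < 4 * a + 6 + extra i
    · exact ⟨x, hx, hp⟩
    by_cases h1 : x = δ'
    · exact ⟨δ, by simpa [h1, t_δ'] using ht x hx, hδ⟩
    by_cases h2 : x = ε
    · have h3 : s a i ε = δ' := by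
        apply pos_injective
        rw [pos_s]
        simp (disch := omega) only [pos, rot, if_pos, if_neg]
      have h4 := ht _ (hs x hx)
      rw [h2, h3, t_δ'] at h4
      exact ⟨δ, h4, hδ⟩
    have h3 : x = β' := eq_β'_of_not_lt hp h1 h2
    exact ⟨β, by simpa [h3, t_β'] using ht x hx, hβ⟩
  obtain ⟨x, hx, hpx⟩ := hx
  rw [Set.eq_univ_iff_forall]
  intro y
  by_cases hp : pos y < 4 * a + 6 + extra i
  · exact hcyc x hx hpx y hp
  have hδ'B : δ' ∈ B := t_δ (a := a) (i := i) ▸ ht _ (hcyc x hx hpx _ hδ)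
  by_cases h1 : y = δ'
  · rwa [h1]
  by_cases h2 : y = ε
  · have h3 : s a i δ' = ε := by
      apply pos_injective
      rw [pos_s]
      simp (disch := omega) only [pos, rot, if_neg]
      simp; omega
    rw [h2, ← h3]
    exact hs _ hδ'B
  have h3 : y = β' := eq_β'_of_not_lt hp h1 h2
  rw [h3, ← t_β]
  exact ht _ (hcyc x hx hpx _ hβ)

theorem s_mem (a : ℕ) (i : ℤ) : s a i ∈ G a i := Subgroup.subset_closure (by simp)

theorem t_mem (a : ℕ) (i : ℤ) : t a i ∈ G a i := Subgroup.subset_closure (by simp)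

instance isPretransitive_G (a : ℕ) (i : ℤ) : MulAction.IsPretransitive (G a i) (Point a i) := by
  refine ⟨fun x y => ?_⟩
  have : MulAction.orbit (G a i) x = Set.univ := by
    apply eq_univ_of_invariant
    · exact fun y hy => MulAction.mem_orbit_of_mem_orbit (⟨_, s_mem a i⟩ : G a i) hy
    · exact fun y hy => MulAction.mem_orbit_of_mem_orbit (⟨_, t_mem a i⟩ : G a i) hy
    · exact ⟨x, MulAction.mem_orbit_self x⟩
  exact (this ▸ Set.mem_univ y : y ∈ MulAction.orbit (G a i) x)

theorem eq_univ_of_mem_stabilizer {B : Set (Point a i)}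
    (hs : (⟨s a i, s_mem a i⟩ : G a i) ∈ MulAction.stabilizer (G a i) B)
    (ht : (⟨t a i, t_mem a i⟩ : G a i) ∈ MulAction.stabilizer (G a i) B)
    (hne : B.Nonempty) : B = Set.univ := by
  apply eq_univ_of_invariant _ _ hne
  · intro x hx
    rw [MulAction.mem_stabilizer_iff] at hs
    rw [← hs]
    exact Set.smul_mem_smul_set hx
  · intro x hx
    rw [MulAction.mem_stabilizer_iff] at ht
    rw [← ht]
    exact Set.smul_mem_smul_set hx

/-- The long cycle has even length, hence is odd, and the extra transposition restores evenness. -/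
theorem sign_s (a : ℕ) (i : ℤ) : Perm.sign (s a i) = 1 := by
  have hmap := map_pos_longCycle a i
  have hnd : (longCycle a i).Nodup := List.Nodup.of_map pos (hmap ▸ List.nodup_range)
  have hlen : (longCycle a i).length = 4 * a + 6 + extra i := by
    simpa using congrArg List.length hmap
  have he : Even (4 * a + 6 + extra i) := by
    rw [Nat.even_iff]; unfold extra; split_ifs <;> omega
  rw [s_eq, Perm.sign_mul, Perm.sign_swap (by simp), (List.isCycle_formPerm hnd (by omega)).sign,
    List.support_formPerm_of_nodup _ hnd (by intro x hx; simp [hx] at hlen; omega),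
    List.toFinset_card_of_nodup hnd, hlen, he.neg_one_pow]
  rfl

/-- There are 2a + 4 transpositions. -/
theorem sign_t (a : ℕ) (i : ℤ) : Perm.sign (t a i) = 1 := by
  have h : Perm.sign ((List.finRange (2 * a)).map fun j =>
      swap (num j : Point a i) (num' j)).prod = 1 := by
    rw [map_list_prod, List.map_map]
    have : (⇑Perm.sign ∘ fun j => swap (num j : Point a i) (num' j)) = fun _ => -1 := by
      funext j
      exact Perm.sign_swap (by simp)
    rw [this]
    simp
  rw [t, Perm.sign_mul, h]
  simp [Perm.sign_mul]

theorem G_le_alternatingGroup (a : ℕ) (i : ℤ) : G a i ≤ alternatingGroup (Point a i) := by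
  rw [G, Subgroup.closure_le]
  rintro g (rfl | rfl)
  · exact sign_s a i
  · exact sign_t a i

end EvenFour

/-- Following the reflection by conjugation with s⁻¹ sends rs to s⁻¹(r⁻¹s⁻¹)s = (rs)⁻¹, which is rs
because rs is an involution. Thus reflexibility can be tested on words in s and t. -/
theorem OrientablyRegularMap.IsReflexible.exists_mulEquiv {G : Type*} [Group G]
    {M : OrientablyRegularMap G} (h : M.IsReflexible) :
    ∃ ψ : G ≃* G, ψ M.s = M.s⁻¹ ∧ ψ (M.r * M.s) = M.r * M.s := by
  obtain ⟨φ, hr, hs⟩ := h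
  have hinv : (M.r * M.s)⁻¹ = M.r * M.s := by
    rw [inv_eq_iff_mul_eq_one, ← pow_two, ← M.involution, pow_orderOf_eq_one]
  refine ⟨φ.trans (MulAut.conj M.s⁻¹), ?_, ?_⟩
  · simp [hs]
  · refine Eq.trans ?_ hinv
    simp [hr, hs, mul_assoc]

namespace EvenFour

open Point Equiv

variable {a : ℕ} {i : ℤ}

/-! ### Branchwise evaluation of `rot` and `mirror`; the order of r. -/

theorem rot_of_add_lt {N k p : ℕ} (h : p + k < N) : rot N k p = p + k := by
  unfold rot; split_ifs <;> omega

theorem rot_of_le_add {N k p : ℕ} (h : p < N) (h' : N ≤ p + k) : rot N k p = p + k - N := by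
  unfold rot; split_ifs <;> omega

theorem rot_of_even {N k p : ℕ} (h : N ≤ p) (h' : k % 2 = 0) : rot N k p = p := by
  unfold rot; split_ifs <;> omega

theorem rot_of_odd {N k p : ℕ} (h : p = N) (h' : k % 2 = 1) : rot N k p = N + 1 := by
  unfold rot; split_ifs <;> omega

theorem rot_of_odd' {N k p : ℕ} (h : p = N + 1) (h' : k % 2 = 1) : rot N k p = N := by
  unfold rot; split_ifs <;> omega

theorem rot_of_gt {N k p : ℕ} (h : N + 1 < p) : rot N k p = p := by
  unfold rot; split_ifs <;> omega

theorem mirror_α {a e b p : ℕ} (h : p = 2 * a) :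
    mirror a e b p = 2 * a + 1 := by
  subst h
  unfold mirror
  rw [if_neg (by omega), if_pos rfl]

theorem mirror_α' {a e b p : ℕ} (h : p = 2 * a + 1) :
    mirror a e b p = 2 * a := by
  subst h
  unfold mirror
  rw [if_neg (by omega), if_neg (by omega), if_pos rfl]

theorem mirror_β {a e b p : ℕ} (h : p = 2 * a + 2) :
    mirror a e b p = b := by
  subst h
  unfold mirror
  rw [if_neg (by omega), if_neg (by omega), if_neg (by omega), if_pos rfl]

theorem mirror_β' {a e b p : ℕ} (h : p = b) (h' : 2 * a + 2 < p) :
    mirror a e b p = 2 * a + 2 := by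
  subst h
  unfold mirror
  rw [if_neg (by omega), if_neg (by omega), if_neg (by omega), if_neg (by omega),
    if_pos rfl]

theorem mirror_ζ {a e b p : ℕ} (h : p = 2 * a + 4) (he : e = 2) (hb : b ≠ p) :
    mirror a e b p = 2 * a + 4 := by
  subst h
  unfold mirror
  rw [if_neg (by omega), if_neg (by omega), if_neg (by omega), if_neg (by omega),
    if_neg (by omega), if_pos ⟨rfl, he⟩]

theorem mirror_γ {a e b p : ℕ} (h : p = 4 * a + 3 + e) (hb : b ≠ p) :
    mirror a e b p = 4 * a + 5 + e := by
  subst h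
  unfold mirror
  rw [if_neg (by omega), if_neg (by omega), if_neg (by omega), if_neg (by omega),
    if_neg (by omega), if_neg (by omega), if_neg (by omega), if_pos rfl]

theorem mirror_γ' {a e b p : ℕ} (h : p = 4 * a + 5 + e) (hb : b ≠ p) :
    mirror a e b p = 4 * a + 3 + e := by
  subst h
  unfold mirror
  rw [if_neg (by omega), if_neg (by omega), if_neg (by omega), if_neg (by omega),
    if_neg (by omega), if_neg (by omega), if_neg (by omega), if_neg (by omega),
    if_pos rfl]

theorem mirror_δ {a e b p : ℕ} (h : p = 4 * a + 4 + e) (hb : b ≠ p) :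
    mirror a e b p = 4 * a + 6 + e := by
  subst h
  unfold mirror
  rw [if_neg (by omega), if_neg (by omega), if_neg (by omega), if_neg (by omega),
    if_neg (by omega), if_neg (by omega), if_neg (by omega), if_neg (by omega),
    if_neg (by omega), if_pos rfl]

theorem mirror_δ' {a e b p : ℕ} (h : p = 4 * a + 6 + e) (hb : b ≠ p) :
    mirror a e b p = 4 * a + 4 + e := by
  subst h
  unfold mirror
  rw [if_neg (by omega), if_neg (by omega), if_neg (by omega), if_neg (by omega),
    if_neg (by omega), if_neg (by omega), if_neg (by omega), if_neg (by omega),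
    if_neg (by omega), if_neg (by omega), if_pos rfl]

theorem mirror_ε {a e b p : ℕ} (h : p = 4 * a + 7 + e) (hb : b ≠ p) :
    mirror a e b p = 4 * a + 7 + e := by
  subst h
  unfold mirror
  rw [if_neg (by omega), if_neg (by omega), if_neg (by omega), if_neg (by omega),
    if_neg (by omega), if_neg (by omega), if_neg (by omega), if_neg (by omega),
    if_neg (by omega), if_neg (by omega), if_neg (by omega)]

theorem pos_rotation {N : ℕ} (hN : N = 4 * a + 6 + extra i) (x : Point a i) :
    pos ((t a i * (s a i)⁻¹) x) = mirror a (extra i) (posβ' a i) (rot N (N - 1) (pos x)) := by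
  rw [Perm.mul_apply, pos_t, ← pow_one (s a i), pos_s_pow_inv (by omega), hN]

set_option linter.unusedSimpArgs false

/-- Away from finitely many points the rotation is p ↦ 4a + 5 - p, an involution. The exceptional
points form the transposition (1, γ), the 4-cycles (α, (2a)', ζ, β) and (δ, γ', δ', ε), and two
fixed points. -/
theorem rotation_periodic_of_extra_eq_two {a : ℕ} (ha : 1 ≤ a) {U : ℕ → ℕ}
    (hU : ∀ p, U p = mirror a 2 (2 * a + 3) (rot (4 * a + 8) (4 * a + 7) p)) :
    U (U (4 * a + 6)) ≠ 4 * a + 6 ∧ ∀ p < 4 * a + 10, U^[4] p = p := by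
  obtain ⟨e1, e2, e3, e4, e5, e6, e7, e8, e9, e10, e11, e12⟩ :
      U 0 = 4 * a + 5 ∧ U (4 * a + 5) = 0 ∧ U (2 * a) = 2 * a + 5 ∧ U (2 * a + 5) = 2 * a + 4 ∧
      U (2 * a + 4) = 2 * a + 2 ∧ U (2 * a + 2) = 2 * a ∧ U (2 * a + 1) = 2 * a + 1 ∧
      U (2 * a + 3) = 2 * a + 3 ∧ U (4 * a + 6) = 4 * a + 7 ∧ U (4 * a + 7) = 4 * a + 8 ∧
      U (4 * a + 8) = 4 * a + 9 ∧ U (4 * a + 9) = 4 * a + 6 := by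
    refine ⟨?_, ?_, ?_, ?_, ?_, ?_, ?_, ?_, ?_, ?_, ?_, ?_⟩ <;>
      -- The branch lemmas act as conditional rewrite rules: `omega` decides which range each
      -- position lies in.
      simp (disch := omega) only [hU, rot_of_add_lt, rot_of_le_add, rot_of_even,
        rot_of_odd, rot_of_odd', rot_of_gt,
        mirror_of_num, mirror_of_num', mirror_α, mirror_α', mirror_β, mirror_β', mirror_ζ, mirror_γ,
        mirror_γ', mirror_δ, mirror_δ', mirror_ε] <;> omega
  have hg : ∀ p, (1 ≤ p ∧ p < 2 * a) ∨ (2 * a + 6 ≤ p ∧ p ≤ 4 * a + 4) →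
      U p = 4 * a + 5 - p := by
    rintro p (h | h) <;> simp (disch := omega) only [hU, rot_of_add_lt, rot_of_le_add, rot_of_even,
        rot_of_odd, rot_of_odd', rot_of_gt,
        mirror_of_num, mirror_of_num', mirror_α, mirror_α', mirror_β, mirror_β', mirror_ζ, mirror_γ,
        mirror_γ', mirror_δ, mirror_δ', mirror_ε] <;> omega
  clear hU
  refine ⟨by rw [e9, e10]; omega, fun p hp => ?_⟩
  by_cases hp' : (1 ≤ p ∧ p < 2 * a) ∨ (2 * a + 6 ≤ p ∧ p ≤ 4 * a + 4)
  · have : U (U p) = p := by rw [hg p hp', hg _ (by omega)]; omega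
    simp [this]
  have hs : p = 0 ∨ p = 4 * a + 5 ∨ p = 2 * a ∨ p = 2 * a + 5 ∨ p = 2 * a + 4 ∨
    p = 2 * a + 2 ∨ p = 2 * a + 1 ∨ p = 2 * a + 3 ∨ p = 4 * a + 6 ∨ p = 4 * a + 7 ∨
    p = 4 * a + 8 ∨ p = 4 * a + 9 := by omega
  clear hg hp' hp
  rcases hs with rfl | rfl | rfl | rfl | rfl | rfl | rfl | rfl | rfl | rfl | rfl | rfl <;>
    simp [*]

/-- Same structure without ζ: the first 4-cycle becomes (α, (2a)', β', β), and α' is the only listed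
fixed point. -/
theorem rotation_periodic_of_extra_eq_zero {a : ℕ} (ha : 1 ≤ a) {U : ℕ → ℕ}
    (hU : ∀ p, U p = mirror a 0 (4 * a + 8) (rot (4 * a + 6) (4 * a + 5) p)) :
    U (U (4 * a + 4)) ≠ 4 * a + 4 ∧ ∀ p < 4 * a + 9, U^[4] p = p := by
  obtain ⟨e1, e2, e3, e4, e5, e6, e7, e8, e9, e10, e11⟩ :
      U 0 = 4 * a + 3 ∧ U (4 * a + 3) = 0 ∧ U (2 * a) = 2 * a + 3 ∧ U (2 * a + 3) = 4 * a + 8 ∧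
      U (4 * a + 8) = 2 * a + 2 ∧ U (2 * a + 2) = 2 * a ∧ U (2 * a + 1) = 2 * a + 1 ∧
      U (4 * a + 4) = 4 * a + 5 ∧ U (4 * a + 5) = 4 * a + 6 ∧ U (4 * a + 6) = 4 * a + 7 ∧
      U (4 * a + 7) = 4 * a + 4 := by
    refine ⟨?_, ?_, ?_, ?_, ?_, ?_, ?_, ?_, ?_, ?_, ?_⟩ <;>
      simp (disch := omega) only [hU, rot_of_add_lt, rot_of_le_add, rot_of_even,
        rot_of_odd, rot_of_odd', rot_of_gt,
        mirror_of_num, mirror_of_num', mirror_α, mirror_α', mirror_β, mirror_β', mirror_ζ, mirror_γ,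
        mirror_γ', mirror_δ, mirror_δ', mirror_ε] <;> omega
  have hg : ∀ p, (1 ≤ p ∧ p < 2 * a) ∨ (2 * a + 4 ≤ p ∧ p ≤ 4 * a + 2) →
      U p = 4 * a + 3 - p := by
    rintro p (h | h) <;> simp (disch := omega) only [hU, rot_of_add_lt, rot_of_le_add, rot_of_even,
        rot_of_odd, rot_of_odd', rot_of_gt,
        mirror_of_num, mirror_of_num', mirror_α, mirror_α', mirror_β, mirror_β', mirror_ζ, mirror_γ,
        mirror_γ', mirror_δ, mirror_δ', mirror_ε] <;> omega
  clear hU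
  refine ⟨by rw [e8, e9]; omega, fun p hp => ?_⟩
  by_cases hp' : (1 ≤ p ∧ p < 2 * a) ∨ (2 * a + 4 ≤ p ∧ p ≤ 4 * a + 2)
  · have : U (U p) = p := by rw [hg p hp', hg _ (by omega)]; omega
    simp [this]
  have hs : p = 0 ∨ p = 4 * a + 3 ∨ p = 2 * a ∨ p = 2 * a + 3 ∨ p = 4 * a + 8 ∨
    p = 2 * a + 2 ∨ p = 2 * a + 1 ∨ p = 4 * a + 4 ∨ p = 4 * a + 5 ∨ p = 4 * a + 6 ∨
    p = 4 * a + 7 := by omega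
  clear hg hp' hp
  rcases hs with rfl | rfl | rfl | rfl | rfl | rfl | rfl | rfl | rfl | rfl | rfl <;>
    simp [*]

theorem orderOf_rotation {a : ℕ} (ha : 1 ≤ a) (i : ℤ) :
    orderOf (t a i * (s a i)⁻¹) = 4 := by
  obtain ⟨U, hU⟩ : ∃ U : ℕ → ℕ, ∀ p, U p = mirror a (extra i) (posβ' a i)
    (rot (4 * a + 6 + extra i) (4 * a + 6 + extra i - 1) p) := ⟨_, fun _ => rfl⟩
  have hp : ∀ x, pos ((t a i * (s a i)⁻¹) x) = U (pos x) :=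
    fun x => by rw [hU, pos_rotation rfl]
  have key : U (U (pos (δ : Point a i))) ≠ pos (δ : Point a i) ∧
      ∀ p < 4 * a + 9 + extra i / 2, U^[4] p = p := by
    rw [pos_δ]
    by_cases hi : i = 1
    · simp only [extra, posβ', hi, if_true] at hU ⊢
      exact rotation_periodic_of_extra_eq_two ha hU
    · simp only [extra, posβ', hi, if_false] at hU ⊢
      exact rotation_periodic_of_extra_eq_zero ha hU
  refine orderOf_eq_prime_pow (p := 2) (n := 1) (fun h => key.1 ?_) ?_
  · have h1 := pos_pow_apply hp 2 δ
    rw [show 2 = 2 ^ 1 from rfl, h] at h1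
    exact h1.symm
  · ext x
    apply pos_injective
    rw [pos_pow_apply hp]
    exact key.2 _ (pos_lt x)

/-! ### Reduction of both claims to a suitable 3-cycle. -/

theorem mem_stabilizer_of_block {B : Set (Point a i)} (hB : MulAction.IsBlock (G a i) B)
    {g : Perm (Point a i)} (hg : g ∈ G a i) {x : Point a i} (hx : x ∈ B) (hgx : g x ∈ B) :
    (⟨g, hg⟩ : G a i) ∈ MulAction.stabilizer (G a i) B :=
  hB.smul_eq_of_mem (a := x) hx hgx

theorem apply_mem_of_block {B : Set (Point a i)} (hB : MulAction.IsBlock (G a i) B)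
    {g : Perm (Point a i)} (hg : g ∈ G a i) {x y : Point a i} (hx : x ∈ B) (hgx : g x ∈ B)
    (hy : y ∈ B) : g y ∈ B := by
  have h := mem_stabilizer_of_block hB hg hx hgx
  rw [MulAction.mem_stabilizer_iff] at h
  rw [← h]
  exact Set.smul_mem_smul_set (a := (⟨g, hg⟩ : G a i)) hy

theorem eq_alternatingGroup_of_threeCycle {c : Perm (Point a i)} (hc : c ∈ G a i)
    {x y z : Point a i} (hxy : x ≠ y) (hxz : x ≠ z) (hyz : y ≠ z)
    (h1 : c x = y) (h2 : c y = z) (h3 : c z = x)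
    (hfix : ∀ w, w ≠ x → w ≠ y → w ≠ z → c w = w)
    (H : ∀ B : Set (Point a i), MulAction.IsBlock (G a i) B → x ∈ B → y ∈ B → z ∈ B →
      (⟨s a i, s_mem a i⟩ : G a i) ∈ MulAction.stabilizer (G a i) B ∧
      (⟨t a i, t_mem a i⟩ : G a i) ∈ MulAction.stabilizer (G a i) B) :
    G a i = alternatingGroup (Point a i) := by
  refine le_antisymm (G_le_alternatingGroup a i) ?_
  refine Perm.alternatingGroup_le_of_isPreprimitive_of_isThreeCycle_mem
    (MulAction.isPreprimitive_of_threeCycle hc h1 h2 h3 hfix fun B hB hx hy hz => ?_)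
    (Perm.isThreeCycle_of_apply hxy hxz hyz h1 h2 h3 hfix) hc
  obtain ⟨hs, ht⟩ := H B hB hx hy hz
  exact eq_univ_of_mem_stabilizer hs ht ⟨x, hx⟩

/-- A map on `G` whose generators are `s` and `t` is chiral if inverting `s` and fixing `t` turns
some non-commuting pair of conjugate three-cycles into a commuting pair. -/
theorem isChiral_of_threeCycle {M : OrientablyRegularMap (G a i)}
    (hs : (M.s : Perm (Point a i)) = s a i)
    (ht : ((M.r * M.s : G a i) : Perm (Point a i)) = t a i) {k m p q : ℕ}
    {c g g' : Perm (Point a i)} (hc : c = (t a i * s a i ^ k) ^ m)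
    (hg : g = s a i ^ p * t a i * (s a i ^ q)⁻¹)
    (hg' : g' = (s a i ^ p)⁻¹ * t a i * s a i ^ q) {S : Set (Point a i)}
    (hfix : ∀ w ∉ S, c w = w) {w : Point a i} (h1 : c (g w) ≠ g w)
    (h2 : c (g (c w)) = g (c w)) (hdisj : ∀ u ∈ S, ∀ v ∈ S, g' (t a i u) ≠ t a i v) :
    M.IsChiral := by
  intro hM
  obtain ⟨ψ, hψs, hψt⟩ := hM.exists_mulEquiv
  have htt : ∀ x, t a i (t a i x) = x := fun x => by
    rw [← Perm.mul_apply, t_mul_t, Perm.one_apply]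
  set c' := (t a i * (s a i ^ k)⁻¹) ^ m with hc'
  -- Since t s⁻ᵏ = t (t sᵏ)⁻¹ t, the image c' of c is t c⁻¹ t, so it moves only points of t(S).
  have hcc : c' = t a i * c⁻¹ * (t a i)⁻¹ := by
    rw [hc, ← inv_pow, mul_inv_rev, ← conj_pow, hc', t_inv, mul_assoc, mul_assoc, t_mul_t, mul_one]
  have hfix' : ∀ v, t a i v ∉ S → c' v = v := by
    intro v hv
    rw [hcc, t_inv, Perm.mul_apply, Perm.mul_apply, Perm.inv_eq_iff_eq.mpr (hfix _ hv).symm, htt]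
  -- The hypothesis `hdisj` says that t(S) and its image under g' do not meet, so the two conjugates
  -- are disjoint.
  have hcomm : Commute c' (g' * c' * g'⁻¹) := by
    apply Perm.Disjoint.commute
    intro v
    by_contra! h
    have hv : t a i v ∈ S := by
      by_contra hn
      exact h.1 (hfix' v hn)
    have hv' : t a i (g'⁻¹ v) ∈ S := by
      by_contra hn
      refine h.2 ?_
      have hgv : g' (g'⁻¹ v) = v := by simp
      rw [Perm.mul_apply, Perm.mul_apply, hfix' _ hn, hgv]
    apply hdisj _ hv' _ hv
    simp [htt]
  set T := M.r * M.s with hT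
  set cG : G a i := (T * M.s ^ k) ^ m
  set gG : G a i := M.s ^ p * T * (M.s ^ q)⁻¹
  have e1 : (cG : Perm (Point a i)) = c := by simp [cG, ht, hs, hc]
  have e2 : (gG : Perm (Point a i)) = g := by simp [gG, ht, hs, hg]
  have e3 : (ψ cG : Perm (Point a i)) = c' := by simp [cG, hψt, hψs, ht, hs, hc']
  have e4 : (ψ gG : Perm (Point a i)) = g' := by simp [gG, hψt, hψs, ht, hs, hg']
  have hcommG : cG * (gG * cG * gG⁻¹) = gG * cG * gG⁻¹ * cG := by
    apply ψ.injective
    apply Subtype.ext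
    simpa [e3, e4] using hcomm.eq
  have hcommP : Commute c (g * c * g⁻¹) := by
    have := congrArg (Subtype.val) hcommG
    simpa [e1, e2, commute_iff_eq] using this
  refine not_commute_of_apply (w := g w) h1 ?_ hcommP
  simpa using h2

/-! ### The case i = 1. -/

theorem iterate_twenty_of_extra_eq_two {a : ℕ} (ha : 1 ≤ a) {U : ℕ → ℕ}
    (hU : ∀ p, U p = mirror a 2 (2 * a + 3) (rot (4 * a + 8) 3 p)) :
    ∃ X, (a = 1 ∧ X = 11 ∨ 2 ≤ a ∧ X = 2 * a - 3) ∧ U^[20] X = 2 * a + 4 ∧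
      U^[20] (2 * a + 4) = 2 * a + 1 ∧ U^[20] (2 * a + 1) = X ∧
      ∀ p < 4 * a + 10, p ≠ X → p ≠ 2 * a + 4 → p ≠ 2 * a + 1 → U^[20] p = p := by
  -- Apart from the 3-cycle (X, 2a + 1, 2a + 4), t s³ has one 5-cycle (`e2` to `e6`), one 4-cycle
  -- (`e7` to `e10`) and cycles of length at most 2. The 20th power kills all of these and, as 20 ≡
  -- 2 mod 3, squares the 3-cycle.
  obtain ⟨e1, e2, e3, e4, e5, e6, e7, e8, e9, e10, e11, e12⟩ :
      U (2 * a + 1) = 2 * a + 4 ∧ U (2 * a - 2) = 2 * a ∧ U (2 * a) = 2 * a + 2 ∧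
      U (2 * a + 2) = 2 * a - 1 ∧ U (2 * a - 1) = 2 * a + 3 ∧ U (2 * a + 3) = 2 * a - 2 ∧
      U (4 * a + 3) = 4 * a + 8 ∧ U (4 * a + 8) = 4 * a + 9 ∧ U (4 * a + 9) = 4 * a + 6 ∧
      U (4 * a + 6) = 4 * a + 3 ∧ U (4 * a + 4) = 4 * a + 5 ∧ U (4 * a + 5) = 4 * a + 4 := by
    refine ⟨?_, ?_, ?_, ?_, ?_, ?_, ?_, ?_, ?_, ?_, ?_, ?_⟩ <;>
      simp (disch := omega) only [hU, rot_of_add_lt, rot_of_le_add, rot_of_even,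
        rot_of_odd, rot_of_odd', rot_of_gt,
        mirror_of_num, mirror_of_num', mirror_α, mirror_α', mirror_β, mirror_β', mirror_ζ, mirror_γ,
        mirror_γ', mirror_δ, mirror_δ', mirror_ε] <;> omega
  obtain ⟨X, hX, x1, x2, x3⟩ : ∃ X, (a = 1 ∧ X = 11 ∨ 2 ≤ a ∧ X = 2 * a - 3) ∧ U X = 2 * a + 1 ∧
      U (2 * a + 4) = X ∧ (2 ≤ a → U (4 * a + 2) = 4 * a + 7 ∧ U (4 * a + 7) = 4 * a + 2) := by
    -- X is 2a - 3 modulo N: for a = 1 it wraps around to N - 1 = 11.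
    obtain h | h : a = 1 ∨ 2 ≤ a := by omega
    · refine ⟨11, Or.inl ⟨h, rfl⟩, ?_, ?_, by omega⟩ <;>
        simp (disch := omega) only [hU, rot_of_add_lt, rot_of_le_add, rot_of_even,
        rot_of_odd, rot_of_odd', rot_of_gt,
        mirror_of_num, mirror_of_num', mirror_α, mirror_α', mirror_β, mirror_β', mirror_ζ, mirror_γ,
        mirror_γ', mirror_δ, mirror_δ', mirror_ε] <;> omega
    · refine ⟨2 * a - 3, Or.inr ⟨h, rfl⟩, ?_, ?_, fun _ => ⟨?_, ?_⟩⟩ <;>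
        simp (disch := omega) only [hU, rot_of_add_lt, rot_of_le_add, rot_of_even,
        rot_of_odd, rot_of_odd', rot_of_gt,
        mirror_of_num, mirror_of_num', mirror_α, mirror_α', mirror_β, mirror_β', mirror_ζ, mirror_γ,
        mirror_γ', mirror_δ, mirror_δ', mirror_ε] <;> omega
  have hg : ∀ p, p + 3 < 2 * a ∨ (2 * a + 5 ≤ p ∧ p ≤ 4 * a + 1) → U p = 4 * a + 1 - p := by
    rintro p (h | h) <;> simp (disch := omega) only [hU, rot_of_add_lt, rot_of_le_add, rot_of_even,
        rot_of_odd, rot_of_odd', rot_of_gt,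
        mirror_of_num, mirror_of_num', mirror_α, mirror_α', mirror_β, mirror_β', mirror_ζ, mirror_γ,
        mirror_γ', mirror_δ, mirror_δ', mirror_ε] <;> omega
  clear hU
  refine ⟨X, hX, ?_, ?_, ?_, fun p hp hpX hp1 hp2 => ?_⟩
  · simp only [Function.iterate_succ_apply, Function.iterate_zero, id, x1, x2, e1]
  · simp only [Function.iterate_succ_apply, Function.iterate_zero, id, x1, x2, e1]
  · simp only [Function.iterate_succ_apply, Function.iterate_zero, id, x1, x2, e1]
  by_cases hp' : p + 3 < 2 * a ∨ (2 * a + 5 ≤ p ∧ p ≤ 4 * a + 1)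
  · have : U (U p) = p := by rw [hg p hp', hg _ (by omega)]; omega
    simp only [Function.iterate_succ_apply, Function.iterate_zero, id, this]
  by_cases hp3 : 2 ≤ a ∧ (p = 4 * a + 2 ∨ p = 4 * a + 7)
  · obtain ⟨x4, x5⟩ := x3 hp3.1
    rcases hp3.2 with rfl | rfl <;>
      simp only [Function.iterate_succ_apply, Function.iterate_zero, id, x4, x5]
  have hs : p = 2 * a - 2 ∨ p = 2 * a ∨ p = 2 * a + 2 ∨ p = 2 * a - 1 ∨ p = 2 * a + 3 ∨
    p = 4 * a + 3 ∨ p = 4 * a + 8 ∨ p = 4 * a + 9 ∨ p = 4 * a + 6 ∨ p = 4 * a + 4 ∨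
    p = 4 * a + 5 := by omega
  clear hg hp' hp hX hpX hp1 hp2 hp3
  rcases hs with rfl | rfl | rfl | rfl | rfl | rfl | rfl | rfl | rfl | rfl | rfl <;>
    simp only [Function.iterate_succ_apply, Function.iterate_zero, id, e2, e3, e4, e5, e6, e7, e8,
      e9, e10, e11, e12]

theorem extra_one : extra 1 = 2 := rfl

theorem posβ'_one (a : ℕ) : posβ' a 1 = 2 * a + 3 := rfl

theorem pos_ζ {a : ℕ} : pos (ζ rfl : Point a 1) = 2 * a + 4 := rfl

theorem exists_threeCycle_of_eq_one {a : ℕ} (ha : 1 ≤ a) {c : Perm (Point a 1)}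
    (hc : c = (t a 1 * s a 1 ^ 3) ^ 20) :
    ∃ x : Point a 1, (a = 1 ∧ pos x = 11 ∨ 2 ≤ a ∧ pos x = 2 * a - 3) ∧ c x = ζ rfl ∧
      c (ζ rfl) = α' ∧ c α' = x ∧ ∀ w, w ≠ x → w ≠ ζ rfl → w ≠ α' → c w = w := by
  obtain ⟨U, hU⟩ : ∃ U : ℕ → ℕ, ∀ p, U p = mirror a 2 (2 * a + 3) (rot (4 * a + 8) 3 p) :=
    ⟨_, fun _ => rfl⟩
  have hh : ∀ x, pos ((t a 1 * s a 1 ^ 3) x) = U (pos x) := fun x => by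
    rw [hU, Perm.mul_apply, pos_t, pos_s_pow (by omega)]
    rfl
  obtain ⟨X, hX, h1, h2, h3, h4⟩ := iterate_twenty_of_extra_eq_two ha hU
  obtain ⟨x, rfl⟩ := exists_pos_eq (a := a) (i := 1) (p := X) (by rw [extra_one]; omega)
  have hcp : ∀ w, pos (c w) = U^[20] (pos w) := fun w => by rw [hc, pos_pow_apply hh]
  refine ⟨x, hX, ?_, ?_, ?_, fun w hx hz hα => ?_⟩ <;> apply pos_injective <;> rw [hcp]
  · exact h1
  · exact h2
  · exact h3
  · exact h4 _ (pos_lt w) (pos_injective.ne hx) (pos_injective.ne hz) (pos_injective.ne hα)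

theorem threeCycle_mem_of_eq_one (a : ℕ) : (t a 1 * s a 1 ^ 3) ^ 20 ∈ G a 1 :=
  pow_mem (mul_mem (t_mem a 1) (pow_mem (s_mem a 1) 3)) 20

theorem G_eq_alternatingGroup_of_eq_one {a : ℕ} (ha : 1 ≤ a) :
    G a 1 = alternatingGroup (Point a 1) := by
  obtain ⟨x, hx, h1, h2, h3, h4⟩ := exists_threeCycle_of_eq_one ha rfl
  refine eq_alternatingGroup_of_threeCycle (threeCycle_mem_of_eq_one a) ?_ ?_ (by simp) h1 h2 h3 h4
    fun B hB hxB hζB hαB => ⟨?_, ?_⟩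
  · rintro rfl; rw [pos_ζ] at hx; omega
  · rintro rfl; rw [pos_α'] at hx; omega
  -- Differences 3 and 4 between support points put s³ and s⁴, hence s, in the stabilizer; t is
  -- there because it fixes ζ.
  · have e3 : (s a 1 ^ 3) α' = ζ rfl := by
      apply pos_injective
      rw [pos_s_pow (by omega), pos_α', pos_ζ, extra_one, rot_of_add_lt (by omega)]
    have e4 : (s a 1 ^ 4) x = α' := by
      apply pos_injective
      rw [pos_s_pow (by omega), pos_α', extra_one]
      rcases hx with hx | hx
      · rw [rot_of_le_add (by omega) (by omega)]; omega
      · rw [rot_of_add_lt (by omega)]; omega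
    have m3 := mem_stabilizer_of_block hB (pow_mem (s_mem a 1) 3) hαB (by rwa [e3])
    have m4 := mem_stabilizer_of_block hB (pow_mem (s_mem a 1) 4) hxB (by rwa [e4])
    have : (⟨s a 1, s_mem a 1⟩ : G a 1) =
        ⟨s a 1 ^ 4, pow_mem (s_mem a 1) 4⟩ * (⟨s a 1 ^ 3, pow_mem (s_mem a 1) 3⟩)⁻¹ := by
      apply Subtype.ext
      simp only [Subgroup.coe_mul, Subgroup.coe_inv]
      group
    rw [this]
    exact mul_mem m4 (inv_mem m3)
  · exact mem_stabilizer_of_block hB (t_mem a 1) hζB (by rwa [t_ζ])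

theorem isChiral_of_eq_one {a : ℕ} (ha : 1 ≤ a) {M : OrientablyRegularMap (G a 1)}
    (hs : (M.s : Perm (Point a 1)) = s a 1)
    (ht : ((M.r * M.s : G a 1) : Perm (Point a 1)) = t a 1) : M.IsChiral := by
  obtain ⟨x, hx, h1, h2, h3, h4⟩ := exists_threeCycle_of_eq_one ha rfl
  have hfix : ∀ w ∉ ({x, ζ rfl, α'} : Set (Point a 1)), ((t a 1 * s a 1 ^ 3) ^ 20) w = w := by
    intro w hw
    simp only [Set.mem_insert_iff, Set.mem_singleton_iff, not_or] at hw
    exact h4 w hw.1 hw.2.1 hw.2.2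
  have hg : ∀ w, pos ((s a 1 ^ 1 * t a 1 * (s a 1 ^ 2)⁻¹) w) =
      rot (4 * a + 8) 1 (mirror a 2 (2 * a + 3) (rot (4 * a + 8) (4 * a + 6) (pos w))) := by
    intro w
    rw [Perm.mul_apply, Perm.mul_apply, pos_s_pow (by omega), pos_t, pos_s_pow_inv (by omega)]
    rfl
  have hg' : ∀ w, pos (((s a 1 ^ 1)⁻¹ * t a 1 * s a 1 ^ 2) w) =
      rot (4 * a + 8) (4 * a + 7) (mirror a 2 (2 * a + 3) (rot (4 * a + 8) 2 (pos w))) := by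
    intro w
    rw [Perm.mul_apply, Perm.mul_apply, pos_s_pow_inv (by omega), pos_t, pos_s_pow (by omega)]
    rfl
  -- s⁻² takes ζ to β, t takes β to β', and s returns to ζ. So the supports of c and g c g⁻¹ share
  -- ζ, while g moves α' off the support of c.
  have hgζ : (s a 1 ^ 1 * t a 1 * (s a 1 ^ 2)⁻¹) (ζ rfl) = ζ rfl := by
    apply pos_injective
    rw [hg, pos_ζ]
    simp (disch := omega) only [rot_of_add_lt, rot_of_le_add, rot_of_even,
        rot_of_odd, rot_of_odd', rot_of_gt,
        mirror_of_num, mirror_of_num', mirror_α, mirror_α', mirror_β, mirror_β', mirror_ζ, mirror_γ,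
        mirror_γ', mirror_δ, mirror_δ', mirror_ε]
  have hgα : pos ((s a 1 ^ 1 * t a 1 * (s a 1 ^ 2)⁻¹) α') = 2 * a + 6 := by
    rw [hg, pos_α']
    simp (disch := omega) only [rot_of_add_lt, rot_of_le_add, rot_of_even,
        rot_of_odd, rot_of_odd', rot_of_gt,
        mirror_of_num, mirror_of_num', mirror_α, mirror_α', mirror_β, mirror_β', mirror_ζ, mirror_γ,
        mirror_γ', mirror_δ, mirror_δ', mirror_ε]
    omega
  refine isChiral_of_threeCycle (p := 1) (q := 2) hs ht rfl rfl rfl hfix (w := ζ rfl) ?_ ?_ ?_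
  · rw [hgζ, h2]
    simp
  · rw [h2]
    apply h4 <;> intro h <;> rw [h] at hgα
    · omega
    · rw [pos_ζ] at hgα; omega
    · rw [pos_α'] at hgα; omega
  · have htx : pos (t a 1 x) = 2 * a + 7 := by
      rw [pos_t, extra_one, posβ'_one]
      rcases hx with hx | hx <;> rw [hx.2] <;> simp (disch := omega) only [rot_of_add_lt, rot_of_le_add, rot_of_even,
        rot_of_odd, rot_of_odd', rot_of_gt,
        mirror_of_num, mirror_of_num', mirror_α, mirror_α', mirror_β, mirror_β', mirror_ζ, mirror_γ,
        mirror_γ', mirror_δ, mirror_δ', mirror_ε] <;> omega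
    have htα : pos (t a 1 α') = 2 * a := by rw [t_α']; rfl
    have htζ : pos (t a 1 (ζ rfl)) = 2 * a + 4 := by rw [t_ζ]; rfl
    have e1 := hg' (t a 1 x)
    have e2 := hg' (t a 1 α')
    have e3 := hg' (t a 1 (ζ rfl))
    rw [htx] at e1
    rw [htα] at e2
    rw [htζ] at e3
    -- s² takes position 2a + 7 to 2a + 9, which is γ' for a = 1, γ for a = 2, and a primed numbered
    -- point from a = 3 on.
    obtain h | h | h : a = 1 ∨ a = 2 ∨ 3 ≤ a := by omega
    all_goals
      simp (disch := omega) only [rot_of_add_lt, rot_of_le_add, rot_of_even,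
        rot_of_odd, rot_of_odd', rot_of_gt,
        mirror_of_num, mirror_of_num', mirror_α, mirror_α', mirror_β, mirror_β', mirror_ζ, mirror_γ,
        mirror_γ', mirror_δ, mirror_δ', mirror_ε] at e1 e2 e3
      rintro u (rfl | rfl | rfl) v (rfl | rfl | rfl) h' <;>
        have h'' := congrArg pos h' <;>
        simp only [htx, htα, htζ] at h'' <;>
        omega

/-! ### The case i = -1, a ≥ 2. -/

theorem iterate_fourteen_of_extra_eq_zero {a : ℕ} (ha : 2 ≤ a) {U : ℕ → ℕ}
    (hU : ∀ p, U p = mirror a 0 (4 * a + 8) (rot (4 * a + 6) 4 p)) :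
    U^[14] (4 * a) = 4 * a + 4 ∧ U^[14] (4 * a + 4) = 4 * a + 6 ∧ U^[14] (4 * a + 6) = 4 * a ∧
      ∀ p < 4 * a + 9, p ≠ 4 * a → p ≠ 4 * a + 4 → p ≠ 4 * a + 6 → U^[14] p = p := by
  obtain ⟨x1, x2, x3⟩ :
      U (4 * a) = 4 * a + 6 ∧ U (4 * a + 6) = 4 * a + 4 ∧ U (4 * a + 4) = 4 * a := by
    refine ⟨?_, ?_, ?_⟩ <;> simp (disch := omega) only [hU, rot_of_add_lt, rot_of_le_add, rot_of_even,
        rot_of_odd, rot_of_odd', rot_of_gt,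
        mirror_of_num, mirror_of_num', mirror_α, mirror_α', mirror_β, mirror_β', mirror_ζ, mirror_γ,
        mirror_γ', mirror_δ, mirror_δ', mirror_ε] <;> omega
  -- Besides the 3-cycle there is one 7-cycle (`e1` to `e7`), and all other cycles have length at
  -- most 2. Hence exponent 14 ≡ 2 mod 3. The 7-cycle uses position 2a - 4, which requires a ≥ 2.
  obtain ⟨e1, e2, e3, e4, e5, e6, e7, e8, e9, e10, e11, e12, e13, e14⟩ :
      U (2 * a - 4) = 2 * a + 1 ∧ U (2 * a + 1) = 2 * a - 3 ∧ U (2 * a - 3) = 2 * a ∧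
      U (2 * a) = 2 * a - 2 ∧ U (2 * a - 2) = 4 * a + 8 ∧ U (4 * a + 8) = 2 * a + 2 ∧
      U (2 * a + 2) = 2 * a - 4 ∧ U (2 * a - 1) = 2 * a - 1 ∧ U (4 * a - 1) = 4 * a + 5 ∧
      U (4 * a + 5) = 4 * a - 1 ∧ U (4 * a + 1) = 4 * a + 3 ∧ U (4 * a + 3) = 4 * a + 1 ∧
      U (4 * a + 2) = 4 * a + 2 ∧ U (4 * a + 7) = 4 * a + 7 := by
    refine ⟨?_, ?_, ?_, ?_, ?_, ?_, ?_, ?_, ?_, ?_, ?_, ?_, ?_, ?_⟩ <;>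
      simp (disch := omega) only [hU, rot_of_add_lt, rot_of_le_add, rot_of_even,
        rot_of_odd, rot_of_odd', rot_of_gt,
        mirror_of_num, mirror_of_num', mirror_α, mirror_α', mirror_β, mirror_β', mirror_ζ, mirror_γ,
        mirror_γ', mirror_δ, mirror_δ', mirror_ε] <;> omega
  have hg : ∀ p, p + 4 < 2 * a ∨ (2 * a + 3 ≤ p ∧ p ≤ 4 * a - 2) → U p = 4 * a - 2 - p := by
    rintro p (h | h) <;> simp (disch := omega) only [hU, rot_of_add_lt, rot_of_le_add, rot_of_even,
        rot_of_odd, rot_of_odd', rot_of_gt,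
        mirror_of_num, mirror_of_num', mirror_α, mirror_α', mirror_β, mirror_β', mirror_ζ, mirror_γ,
        mirror_γ', mirror_δ, mirror_δ', mirror_ε] <;> omega
  clear hU
  refine ⟨?_, ?_, ?_, fun p hp hp0 hp1 hp2 => ?_⟩
  iterate 3 simp only [Function.iterate_succ_apply, Function.iterate_zero, id, x1, x2, x3]
  by_cases hp' : p + 4 < 2 * a ∨ (2 * a + 3 ≤ p ∧ p ≤ 4 * a - 2)
  · have : U (U p) = p := by rw [hg p hp', hg _ (by omega)]; omega
    simp only [Function.iterate_succ_apply, Function.iterate_zero, id, this]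
  have hs : p = 2 * a - 4 ∨ p = 2 * a + 1 ∨ p = 2 * a - 3 ∨ p = 2 * a ∨ p = 2 * a - 2 ∨
    p = 4 * a + 8 ∨ p = 2 * a + 2 ∨ p = 2 * a - 1 ∨ p = 4 * a - 1 ∨ p = 4 * a + 5 ∨
    p = 4 * a + 1 ∨ p = 4 * a + 3 ∨ p = 4 * a + 2 ∨ p = 4 * a + 7 := by omega
  clear hg hp' hp hp0 hp1 hp2
  rcases hs with rfl | rfl | rfl | rfl | rfl | rfl | rfl | rfl | rfl | rfl | rfl | rfl | rfl | rfl <;>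
    simp only [Function.iterate_succ_apply, Function.iterate_zero, id, e1, e2, e3, e4, e5, e6, e7,
      e8, e9, e10, e11, e12, e13, e14]

theorem extra_neg_one : extra (-1) = 0 := rfl

theorem posβ'_neg_one (a : ℕ) : posβ' a (-1) = 4 * a + 8 := rfl

theorem exists_threeCycle_of_eq_neg_one {a : ℕ} (ha : 2 ≤ a) {c : Perm (Point a (-1))}
    (hc : c = (t a (-1) * s a (-1) ^ 4) ^ 14) :
    ∃ x : Point a (-1), pos x = 4 * a ∧ c x = δ ∧ c δ = δ' ∧ c δ' = x ∧
      ∀ w, w ≠ x → w ≠ δ → w ≠ δ' → c w = w := by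
  obtain ⟨U, hU⟩ : ∃ U : ℕ → ℕ, ∀ p, U p = mirror a 0 (4 * a + 8) (rot (4 * a + 6) 4 p) :=
    ⟨_, fun _ => rfl⟩
  have hh : ∀ x, pos ((t a (-1) * s a (-1) ^ 4) x) = U (pos x) := fun x => by
    rw [hU, Perm.mul_apply, pos_t, pos_s_pow (by omega)]
    rfl
  obtain ⟨h1, h2, h3, h4⟩ := iterate_fourteen_of_extra_eq_zero ha hU
  obtain ⟨x, hx⟩ := exists_pos_eq (a := a) (i := -1) (p := 4 * a) (by omega)
  have hcp : ∀ w, pos (c w) = U^[14] (pos w) := fun w => by rw [hc, pos_pow_apply hh]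
  refine ⟨x, hx, ?_, ?_, ?_, fun w hwx hwδ hwδ' => ?_⟩ <;> (try apply pos_injective) <;> rw [hcp]
  · rw [hx]; exact h1
  · exact h2
  · rw [hx]; exact h3
  · exact h4 _ (pos_lt w) (hx ▸ pos_injective.ne hwx) (pos_injective.ne hwδ)
      (pos_injective.ne hwδ')

theorem G_eq_alternatingGroup_of_eq_neg_one {a : ℕ} (ha : 2 ≤ a) :
    G a (-1) = alternatingGroup (Point a (-1)) := by
  obtain ⟨x, hx, h1, h2, h3, h4⟩ := exists_threeCycle_of_eq_neg_one ha rfl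
  refine eq_alternatingGroup_of_threeCycle
    (pow_mem (mul_mem (t_mem a (-1)) (pow_mem (s_mem a (-1)) 4)) 14) ?_ ?_ (by simp) h1 h2 h3 h4
    fun B hB hxB hδB hδ'B => ?_
  · rintro rfl; rw [pos_δ] at hx; omega
  · rintro rfl; rw [pos_δ'] at hx; omega
  have ht := mem_stabilizer_of_block hB (t_mem a (-1)) hδB (by rwa [t_δ])
  refine ⟨?_, ht⟩
  -- s² fixes δ', so it preserves the block; its power s^(2a+2) carries δ to α. Then α' = t α = s α
  -- also lies in the block, which gives s itself.
  have e2 : (s a (-1) ^ 2) δ' = δ' := by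
    apply pos_injective
    rw [pos_s_pow (by omega), pos_δ', extra_neg_one, rot_of_even (by omega) (by omega)]
  have m2 := mem_stabilizer_of_block hB (pow_mem (s_mem a (-1)) 2) hδ'B (by rwa [e2])
  have hα : (s a (-1) ^ (2 * (a + 1))) δ = α := by
    apply pos_injective
    rw [pos_s_pow (by omega), pos_δ, pos_α, extra_neg_one, rot_of_le_add (by omega) (by omega)]
    omega
  have hαB : α ∈ B := by
    have h := pow_mem m2 (a + 1)
    rw [MulAction.mem_stabilizer_iff] at h
    have h5 := Set.smul_mem_smul_set (a := (⟨s a (-1) ^ 2, pow_mem (s_mem a (-1)) 2⟩ :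
      G a (-1)) ^ (a + 1)) hδB
    rw [h] at h5
    rw [← hα, pow_mul]
    exact h5
  have hα'B : α' ∈ B := t_α (a := a) (i := -1) ▸
    apply_mem_of_block hB (t_mem a (-1)) hδB (by rwa [t_δ]) hαB
  refine mem_stabilizer_of_block hB (s_mem a (-1)) hαB ?_
  have h5 : s a (-1) α = α' := by
    apply pos_injective
    rw [pos_s, pos_α, pos_α', rot_of_add_lt (by omega)]
  rwa [h5]

theorem isChiral_of_eq_neg_one {a : ℕ} (ha : 2 ≤ a) {M : OrientablyRegularMap (G a (-1))}
    (hs : (M.s : Perm (Point a (-1))) = s a (-1))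
    (ht : ((M.r * M.s : G a (-1)) : Perm (Point a (-1))) = t a (-1)) : M.IsChiral := by
  obtain ⟨x, hx, h1, h2, h3, h4⟩ := exists_threeCycle_of_eq_neg_one ha rfl
  have hfix : ∀ w ∉ ({x, δ, δ'} : Set (Point a (-1))),
      ((t a (-1) * s a (-1) ^ 4) ^ 14) w = w := by
    intro w hw
    simp only [Set.mem_insert_iff, Set.mem_singleton_iff, not_or] at hw
    exact h4 w hw.1 hw.2.1 hw.2.2
  have hg : ∀ w, pos ((s a (-1) ^ (2 * a - 1) * t a (-1) * (s a (-1) ^ (2 * a))⁻¹) w) =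
      rot (4 * a + 6) (2 * a - 1)
        (mirror a 0 (4 * a + 8) (rot (4 * a + 6) (4 * a + 6 - 2 * a) (pos w))) := by
    intro w
    rw [Perm.mul_apply, Perm.mul_apply, pos_s_pow (by omega), pos_t, pos_s_pow_inv (by omega)]
    rfl
  have hg' : ∀ w, pos (((s a (-1) ^ (2 * a - 1))⁻¹ * t a (-1) * s a (-1) ^ (2 * a)) w) =
      rot (4 * a + 6) (4 * a + 6 - (2 * a - 1))
        (mirror a 0 (4 * a + 8) (rot (4 * a + 6) (2 * a) (pos w))) := by
    intro w
    rw [Perm.mul_apply, Perm.mul_apply, pos_s_pow_inv (by omega), pos_t, pos_s_pow (by omega)]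
    rfl
  -- The exponents route x through α and α': s^(-2a) takes position 4a to 2a, t moves it to 2a + 1,
  -- and s^(2a-1) returns to 4a.
  have hgx : (s a (-1) ^ (2 * a - 1) * t a (-1) * (s a (-1) ^ (2 * a))⁻¹) x = x := by
    apply pos_injective
    rw [hg, hx]
    simp (disch := omega) only [rot_of_add_lt, rot_of_le_add, rot_of_even,
        rot_of_odd, rot_of_odd', rot_of_gt,
        mirror_of_num, mirror_of_num', mirror_α, mirror_α', mirror_β, mirror_β', mirror_ζ, mirror_γ,
        mirror_γ', mirror_δ, mirror_δ', mirror_ε]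
    omega
  have hgδ : pos ((s a (-1) ^ (2 * a - 1) * t a (-1) * (s a (-1) ^ (2 * a))⁻¹) δ) =
      4 * a - 3 := by
    rw [hg, pos_δ, extra_neg_one]
    simp (disch := omega) only [rot_of_add_lt, rot_of_le_add, rot_of_even,
        rot_of_odd, rot_of_odd', rot_of_gt,
        mirror_of_num, mirror_of_num', mirror_α, mirror_α', mirror_β, mirror_β', mirror_ζ, mirror_γ,
        mirror_γ', mirror_δ, mirror_δ', mirror_ε]
    omega
  refine isChiral_of_threeCycle (p := 2 * a - 1) (q := 2 * a) hs ht rfl rfl rfl hfix (w := x) ?_ ?_ ?_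
  · rw [hgx, h1]
    rintro rfl
    rw [pos_δ] at hx
    omega
  · rw [h1]
    apply h4 <;> intro h <;> rw [h] at hgδ
    · omega
    · rw [pos_δ] at hgδ; omega
    · rw [pos_δ'] at hgδ; omega
  · have htx : pos (t a (-1) x) = 2 := by
      rw [pos_t, extra_neg_one, posβ'_neg_one, hx]
      simp (disch := omega) only [rot_of_add_lt, rot_of_le_add, rot_of_even,
        rot_of_odd, rot_of_odd', rot_of_gt,
        mirror_of_num, mirror_of_num', mirror_α, mirror_α', mirror_β, mirror_β', mirror_ζ, mirror_γ,
        mirror_γ', mirror_δ, mirror_δ', mirror_ε]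
      omega
    have htδ : pos (t a (-1) δ) = 4 * a + 6 := by rw [t_δ]; rfl
    have htδ' : pos (t a (-1) δ') = 4 * a + 4 := by rw [t_δ']; rfl
    have e1 := hg' (t a (-1) x)
    have e2 := hg' (t a (-1) δ)
    have e3 := hg' (t a (-1) δ')
    rw [htx] at e1
    rw [htδ] at e2
    rw [htδ'] at e3
    simp (disch := omega) only [rot_of_add_lt, rot_of_le_add, rot_of_even,
        rot_of_odd, rot_of_odd', rot_of_gt,
        mirror_of_num, mirror_of_num', mirror_α, mirror_α', mirror_β, mirror_β', mirror_ζ, mirror_γ,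
        mirror_γ', mirror_δ, mirror_δ', mirror_ε] at e1 e2 e3
    rintro u (rfl | rfl | rfl) v (rfl | rfl | rfl) h' <;>
      have h'' := congrArg pos h' <;>
      simp only [htx, htδ, htδ'] at h'' <;>
      omega

/-! ### The exceptional case i = -1, a = 1, on 13 points. -/

theorem G_one_neg_one_eq_alternatingGroup : G 1 (-1) = alternatingGroup (Point 1 (-1)) := by
  -- Here N = 10, β' sits at position 12, and s⁻⁴ acts as s⁶. The word t s t s⁻⁴ has cycle lengths
  -- 8, 3, 2, so its 8th power is a 3-cycle.
  have hh : ∀ x, pos ((t 1 (-1) * s 1 (-1) ^ 1 * (t 1 (-1) * (s 1 (-1) ^ 4)⁻¹)) x) =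
      (fun p => mirror 1 0 12 (rot 10 1 (mirror 1 0 12 (rot 10 6 p)))) (pos x) := fun x => by
    rw [Perm.mul_apply, Perm.mul_apply, Perm.mul_apply, pos_t, pos_s_pow (by omega), pos_t,
      pos_s_pow_inv (by omega)]
    rfl
  have hc := pos_pow_apply (U := fun p => mirror 1 0 12 (rot 10 1 (mirror 1 0 12 (rot 10 6 p)))) hh 8
  have hcG : (t 1 (-1) * s 1 (-1) ^ 1 * (t 1 (-1) * (s 1 (-1) ^ 4)⁻¹)) ^ 8 ∈ G 1 (-1) :=
    pow_mem (mul_mem (mul_mem (t_mem _ _) (pow_mem (s_mem _ _) 1))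
      (mul_mem (t_mem _ _) (inv_mem (pow_mem (s_mem _ _) 4)))) 8
  have hfix : ∀ p < 13, p ≠ 1 → p ≠ 12 → p ≠ 6 →
      (fun p => mirror 1 0 12 (rot 10 1 (mirror 1 0 12 (rot 10 6 p))))^[8] p = p := by decide +kernel
  refine eq_alternatingGroup_of_threeCycle (x := num 1) (y := β') (z := num' 0) hcG (by simp)
    (by simp) (by simp) ?_ ?_ ?_ ?_ fun B hB hx hy hz => ?_
  · apply pos_injective; rw [hc]; rfl
  · apply pos_injective; rw [hc]; rfl
  · apply pos_injective; rw [hc]; rfl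
  · intro w h1 h2 h3
    apply pos_injective
    rw [hc]
    exact hfix _ (pos_lt w) (pos_injective.ne h1) (pos_injective.ne h2) (pos_injective.ne h3)
  -- s fixes β', so it preserves the block; t then does too, because t and s⁴ agree on `num 1`.
  · have e1 : s 1 (-1) β' = β' := by
      apply pos_injective; rw [pos_s]; rfl
    have hs := mem_stabilizer_of_block hB (s_mem _ _) hy (by rwa [e1])
    refine ⟨hs, ?_⟩
    have e2 : (s 1 (-1) ^ 4) (num 1) = num' 1 := by
      apply pos_injective; rw [pos_s_pow (by omega)]; rfl
    have h5 := pow_mem hs 4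
    rw [MulAction.mem_stabilizer_iff] at h5
    have h6 := Set.smul_mem_smul_set (a := (⟨s 1 (-1), s_mem 1 (-1)⟩ : G 1 (-1)) ^ 4) hx
    rw [h5] at h6
    refine mem_stabilizer_of_block hB (t_mem _ _) hx ?_
    rw [t_num, ← e2]
    exact h6

theorem isChiral_of_one_neg_one {M : OrientablyRegularMap (G 1 (-1))}
    (hs : (M.s : Perm (Point 1 (-1))) = s 1 (-1))
    (ht : ((M.r * M.s : G 1 (-1)) : Perm (Point 1 (-1))) = t 1 (-1)) : M.IsChiral := by
  intro hM
  obtain ⟨ψ, hψs, hψt⟩ := hM.exists_mulEquiv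
  have h1 : ∀ x, pos ((t 1 (-1) * (s 1 (-1) ^ 1)⁻¹ * (t 1 (-1) * s 1 (-1) ^ 1) *
      (t 1 (-1) * (s 1 (-1) ^ 4)⁻¹)) x) =
      (fun p => mirror 1 0 12 (rot 10 9 (mirror 1 0 12 (rot 10 1
        (mirror 1 0 12 (rot 10 6 p)))))) (pos x) := fun x => by
    rw [Perm.mul_apply, Perm.mul_apply, Perm.mul_apply, Perm.mul_apply, Perm.mul_apply, pos_t,
      pos_s_pow_inv (by omega), pos_t, pos_s_pow (by omega), pos_t, pos_s_pow_inv (by omega)]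
    rfl
  have h2 : ∀ x, pos ((t 1 (-1) * s 1 (-1) ^ 1 * (t 1 (-1) * (s 1 (-1) ^ 1)⁻¹) *
      (t 1 (-1) * s 1 (-1) ^ 4)) x) =
      (fun p => mirror 1 0 12 (rot 10 1 (mirror 1 0 12 (rot 10 9
        (mirror 1 0 12 (rot 10 4 p)))))) (pos x) := fun x => by
    rw [Perm.mul_apply, Perm.mul_apply, Perm.mul_apply, Perm.mul_apply, Perm.mul_apply, pos_t,
      pos_s_pow (by omega), pos_t, pos_s_pow_inv (by omega), pos_t, pos_s_pow (by omega)]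
    rfl
  have h3 : ∀ p < 13, (fun p => mirror 1 0 12 (rot 10 9 (mirror 1 0 12 (rot 10 1
      (mirror 1 0 12 (rot 10 6 p))))))^[30] p = p := by decide +kernel
  set T := M.r * M.s
  -- The word t s⁻¹ t s t s⁻⁴ has cycle lengths 5, 3, 2, 2, 1. Its image t s t s⁻¹ t s⁴ has cycle
  -- lengths 9, 3, 1, with α in the 9-cycle, so the 30th power of the image moves α.
  have e1 : (T * (M.s ^ 1)⁻¹ * (T * M.s ^ 1) * (T * (M.s ^ 4)⁻¹)) ^ 30 = 1 := by
    apply Subtype.ext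
    ext x
    apply pos_injective
    simp only [Subgroup.coe_mul, Subgroup.coe_inv, Subgroup.coe_pow, ht, hs]
    rw [pos_pow_apply (U := fun p => mirror 1 0 12 (rot 10 9 (mirror 1 0 12 (rot 10 1
      (mirror 1 0 12 (rot 10 6 p)))))) h1]
    exact h3 _ (pos_lt x)
  have e2 := congrArg ψ e1
  simp only [map_pow, map_mul, map_inv, map_one, hψs, hψt, inv_pow, inv_inv] at e2
  have e3 := congrArg (fun g : G 1 (-1) => pos ((g : Perm (Point 1 (-1))) α)) e2
  simp only [Subgroup.coe_mul, Subgroup.coe_inv, Subgroup.coe_pow, ht, hs] at e3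
  rw [pos_pow_apply (U := fun p => mirror 1 0 12 (rot 10 1 (mirror 1 0 12 (rot 10 9
      (mirror 1 0 12 (rot 10 4 p)))))) h2] at e3
  revert e3
  decide +kernel

/-! ### Assembling the cases and constructing the map. -/

theorem G_eq_alternatingGroup {a : ℕ} (ha : 1 ≤ a) {i : ℤ} (hi : i = -1 ∨ i = 1) :
    G a i = alternatingGroup (Point a i) := by
  rcases hi with rfl | rfl
  · obtain rfl | h : a = 1 ∨ 2 ≤ a := by omega
    · exact G_one_neg_one_eq_alternatingGroup
    · exact G_eq_alternatingGroup_of_eq_neg_one h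
  · exact G_eq_alternatingGroup_of_eq_one ha

theorem isChiral {a : ℕ} (ha : 1 ≤ a) {i : ℤ} (hi : i = -1 ∨ i = 1)
    {M : OrientablyRegularMap (G a i)} (hs : (M.s : Perm (Point a i)) = s a i)
    (ht : ((M.r * M.s : G a i) : Perm (Point a i)) = t a i) : M.IsChiral := by
  rcases hi with rfl | rfl
  · obtain rfl | h : a = 1 ∨ 2 ≤ a := by omega
    · exact isChiral_of_one_neg_one hs ht
    · exact isChiral_of_eq_neg_one h hs ht
  · exact isChiral_of_eq_one ha hs ht

theorem closure_rotations_eq_top (a : ℕ) (i : ℤ) :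
    Subgroup.closure ({⟨t a i * (s a i)⁻¹, mul_mem (t_mem a i) (inv_mem (s_mem a i))⟩,
      ⟨s a i, s_mem a i⟩} : Set (G a i)) = ⊤ := by
  set H := Subgroup.closure ({⟨t a i * (s a i)⁻¹, mul_mem (t_mem a i) (inv_mem (s_mem a i))⟩,
      ⟨s a i, s_mem a i⟩} : Set (G a i))
  have hs : (⟨s a i, s_mem a i⟩ : G a i) ∈ H := Subgroup.subset_closure (by simp)
  have hr : (⟨t a i * (s a i)⁻¹, mul_mem (t_mem a i) (inv_mem (s_mem a i))⟩ : G a i) ∈ H :=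
    Subgroup.subset_closure (by simp)
  have ht : (⟨t a i, t_mem a i⟩ : G a i) ∈ H := by
    convert mul_mem hr hs using 1
    apply Subtype.ext
    simp
  have hle : G a i ≤ H.map (G a i).subtype := by
    refine (Subgroup.closure_le _).mpr ?_
    rintro g (rfl | rfl)
    · exact ⟨_, hs, rfl⟩
    · exact ⟨_, ht, rfl⟩
  rw [eq_top_iff]
  rintro ⟨g, hg⟩ -
  obtain ⟨g', hg', rfl⟩ := hle hg
  exact hg'

/-- The map `M(G : r, s)` with `r = t * s⁻¹`. -/
def rotationMap (a : ℕ) (i : ℤ) : OrientablyRegularMap (G a i) where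
  r := ⟨t a i * (s a i)⁻¹, mul_mem (t_mem a i) (inv_mem (s_mem a i))⟩
  s := ⟨s a i, s_mem a i⟩
  generate := closure_rotations_eq_top a i
  involution := by
    rw [← Subgroup.orderOf_coe]
    refine orderOf_eq_prime ?_ ?_
    · simp [pow_two, t_mul_t]
    · simpa using t_ne_one a i

end EvenFour

/-- In the conclusion `M` is the map `M(G : r, s)`, where `r` is determined by `r * s = t`.
Reading products right to left or left to right changes `r` only by conjugation with `t`. -/
theorem proposition4p1 (a n : ℕ) (i : ℤ) (ha : 1 ≤ a) (hi : i = -1 ∨ i = 1)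
    (hn : (n : ℤ) = 4 * (a : ℤ) + 7 + i) :
    EvenFour.G a i = alternatingGroup (EvenFour.Point a i) ∧
    Fintype.card (EvenFour.Point a i) = (if i = 1 then n + 2 else n + 3) ∧
    ∃ M : OrientablyRegularMap (EvenFour.G a i),
      (M.s : Equiv.Perm (EvenFour.Point a i)) = EvenFour.s a i ∧
      ((M.r * M.s : EvenFour.G a i) : Equiv.Perm (EvenFour.Point a i)) = EvenFour.t a i ∧
      M.HasType 4 n ∧ M.IsChiral := by
  have hne : n = 4 * a + 6 + EvenFour.extra i := by
    rcases hi with rfl | rfl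
    · rw [EvenFour.extra_neg_one]; omega
    · rw [EvenFour.extra_one]; omega
  have hM : (((EvenFour.rotationMap a i).r * (EvenFour.rotationMap a i).s : EvenFour.G a i) :
      Equiv.Perm (EvenFour.Point a i)) = EvenFour.t a i := by
    simp [EvenFour.rotationMap]
  refine ⟨EvenFour.G_eq_alternatingGroup ha hi, ?_, EvenFour.rotationMap a i, rfl, hM,
    ⟨?_, ?_⟩, EvenFour.isChiral ha hi rfl hM⟩
  · rw [EvenFour.card_point, hne]
    unfold EvenFour.extra
    split_ifs <;> omega
  · rw [← Subgroup.orderOf_coe]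
    exact EvenFour.orderOf_rotation ha i
  · rw [← Subgroup.orderOf_coe, hne]
    exact EvenFour.orderOf_s a i
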